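/- Let $\Delta=\mathbb{C}\oplus\bigwedge^2\mathbb{C}^6\oplus\bigwedge^4\mathbb{C}^6\oplus\bigwedge^6\mathbb{C}^6$ be the (even) half-spin representation of $\mathfrak{so}_{12}$, of dimension $32$, where $\mathfrak{so}_{12}$ is the Lie algebra of the quadratic space $\mathbb{C}^{12}=\mathbb{C}^6\oplus(\mathbb{C}^6)^*$. Let $$\mathfrak{e}_7=\mathbb{C}^*\oplus\Delta^*\oplus(\mathfrak{so}_{12}\oplus\mathbb{C})\oplus\Delta\oplus\mathbb{C}$$ be the type $\mathrm{II}$ grading of $\mathfrak{e}_7$, with summands in degrees $-2,-1,0,1,2$. Write $$x=x_0+\sum_{i<j}x_{ij}\,e_i\wedge e_j+\sum_{i<j}y_{ij}\,(e_i\wedge e_j)^*+y_0\,\omega\in\Delta,$$ where $\omega=e_6\wedge e_5\wedge\cdots\wedge e_1$ and $(e_i\wedge e_j)^*$ is the multiple of the product of the remaining four basis vectors such that $e_i\wedge e_j\wedge(e_i\wedge e_j)^*=\omega$. The Igusa quartic is $$P_{\mathrm{Spin}_{12}}(x)=x_0\operatorname{Pf}(y_{ij})+y_0\operatorname{Pf}(x_{ij})+\sum_{i<j}\operatorname{Pf}(X_{ij})\operatorname{Pf}(Y_{ij})-\tfrac14\Big(x_0y_0-\sum_{i<j}x_{ij}y_{ij}\Big)^2,$$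 where $(x_{ij})$, $(y_{ij})$ are the alternating $6\times6$ matrices with these entries and $X_{ij}$ (resp. $Y_{ij}$) is obtained from $(x_{ij})$ (resp. $(y_{ij})$) by crossing out the $i$-th and $j$-th lines and columns. Let $X_{-\beta}$ and $X_{\beta}$ be generators of the summands of degree $-2$ and $2$. For $z\in\Delta$ the operator $(\mathrm{ad}_z)^2$ maps $\mathfrak{so}_{12}$ to $\mathbb{C}X_\beta$. Using the invariant form $(M,A)\mapsto\operatorname{tr}(MA)$ to identify $\mathfrak{so}_{12}^*$ with $\mathfrak{so}_{12}\subset\mathfrak{gl}_{12}$, we regard $(\mathrm{ad}_z)^2$ as a $12\times12$ matrix: the unique $M_z\in\mathfrak{so}_{12}$ with $(\mathrm{ad}_z)^2(A)=\operatorname{tr}(M_zA)\,X_\beta$ for all $A\in\mathfrak{so}_{12}$. Then: 1. The entries of $M_z$ are quadratic forms in $z$, and there are non-zero constants $a,c\in\mathbb{C}$, depending only on the generators, such that $(\mathrm{ad}_z)^4(X_{-\beta})=a\,P_{\mathrm{Spin}_{12}}(z)\,X_\beta$ for all $z\in\Delta$, and $(M_z,M_z)$ is a matrix factorization of $c\,P_{\mathrm{Spin}_{12}}$,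 that is, $M_z\cdot M_z=c\,P_{\mathrm{Spin}_{12}}(z)\,I_{12}$ as matrices of polynomials on $\Delta$. 2. The generators $X_{-\beta}$, $X_\beta$ can be chosen such that $a=c=1$; then $((\mathrm{ad}_z)^2,(\mathrm{ad}_z)^2)_{z\in\Delta}$ is a matrix factorization of $P_{\mathrm{Spin}_{12}}$ itself. -/

import Mathlib

noncomputable section

namespace SpinE7

section

attribute [local instance 100] LieRing.ofAssociativeRing

/-- The even orthogonal Lie algebra `𝔰𝔬₁₂`: the `12 × 12` matrices that are skew-adjoint for the
split symmetric form pairing the basis vector `inl i` with `inr i`. -/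
abbrev so12 : LieSubalgebra ℂ (Matrix (Fin 6 ⊕ Fin 6) (Fin 6 ⊕ Fin 6) ℂ) :=
  LieAlgebra.Orthogonal.typeD (Fin 6) ℂ

theorem mem_so12_iff (A : Matrix (Fin 6 ⊕ Fin 6) (Fin 6 ⊕ Fin 6) ℂ) :
    A ∈ so12 ↔ ∀ p q, A p.swap q = - A q.swap p := by
  have key : ∀ (p q : Fin 6 ⊕ Fin 6), (A.transpose * LieAlgebra.Orthogonal.JD (Fin 6) ℂ) p q
      = A q.swap p := by
    intro p q
    rcases q with q | q <;>
    simp [LieAlgebra.Orthogonal.JD, Matrix.mul_apply, Matrix.fromBlocks, Matrix.one_apply]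
  have key2 : ∀ (p q : Fin 6 ⊕ Fin 6), (LieAlgebra.Orthogonal.JD (Fin 6) ℂ * (-A)) p q
      = - A p.swap q := by
    intro p q
    rcases p with p | p <;>
    simp [LieAlgebra.Orthogonal.JD, Matrix.mul_apply, Matrix.fromBlocks, Matrix.one_apply]
  rw [so12, LieAlgebra.Orthogonal.typeD, mem_skewAdjointMatricesLieSubalgebra,
    mem_skewAdjointMatricesSubmodule, Matrix.IsSkewAdjoint, Matrix.IsAdjointPair]
  constructor
  · intro h p q
    have := congrFun (congrFun h q) p
    rw [key, key2] at this
    exact this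
  · intro h
    ext p q
    rw [key, key2, h]

end

/-- The exterior algebra of `ℂ⁶`, an element being given by its coordinates: the coordinate at
`S = {i₁ < … < iₖ}` is the coefficient of `e_{i₁} ∧ … ∧ e_{iₖ}`. -/
def Fock : Type := Finset (Fin 6) → ℂ

instance : AddCommGroup Fock := inferInstanceAs (AddCommGroup (Finset (Fin 6) → ℂ))

instance : Module ℂ Fock := inferInstanceAs (Module ℂ (Finset (Fin 6) → ℂ))

@[simp] theorem Fock.add_apply (f g : Fock) (S : Finset (Fin 6)) : (f + g) S = f S + g S := rfl

@[simp] theorem Fock.sub_apply (f g : Fock) (S : Finset (Fin 6)) : (f - g) S = f S - g S := rfl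

@[simp] theorem Fock.smul_apply (c : ℂ) (f : Fock) (S : Finset (Fin 6)) :
    (c • f) S = c * f S := rfl

@[simp] theorem Fock.zero_apply (S : Finset (Fin 6)) : (0 : Fock) S = 0 := rfl

@[ext] theorem Fock.ext {f g : Fock} (h : ∀ S, f S = g S) : f = g := funext h

/-- The sign of moving `e_i` past the factors `e_j`, `j ∈ S`, `j < i`. -/
def moveSign (i : Fin 6) (S : Finset (Fin 6)) : ℂ := (-1) ^ (S.filter (· < i)).card

/-- Left exterior multiplication by `e_i`. -/
def wedge (i : Fin 6) : Module.End ℂ Fock where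
  toFun f S := if i ∈ S then moveSign i S * f (S.erase i) else 0
  map_add' f g := Fock.ext fun S => by
    change (if i ∈ S then moveSign i S * (f (S.erase i) + g (S.erase i)) else 0)
      = (if i ∈ S then moveSign i S * f (S.erase i) else 0)
        + (if i ∈ S then moveSign i S * g (S.erase i) else 0)
    split_ifs <;> ring
  map_smul' c f := Fock.ext fun S => by
    change (if i ∈ S then moveSign i S * (c * f (S.erase i)) else 0)
      = c * (if i ∈ S then moveSign i S * f (S.erase i) else 0)
    split_ifs <;> ring

/-- Contraction with the dual basis vector `e_i^*`. -/
def contract (i : Fin 6) : Module.End ℂ Fock where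
  toFun f S := if i ∈ S then 0 else moveSign i S * f (insert i S)
  map_add' f g := Fock.ext fun S => by
    change (if i ∈ S then 0 else moveSign i S * (f (insert i S) + g (insert i S)))
      = (if i ∈ S then 0 else moveSign i S * f (insert i S))
        + (if i ∈ S then 0 else moveSign i S * g (insert i S))
    split_ifs <;> ring
  map_smul' c f := Fock.ext fun S => by
    change (if i ∈ S then 0 else moveSign i S * (c * f (insert i S)))
      = c * (if i ∈ S then 0 else moveSign i S * f (insert i S))
    split_ifs <;> ring

theorem wedge_apply (i : Fin 6) (f : Fock) (S : Finset (Fin 6)) :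
    wedge i f S = if i ∈ S then moveSign i S * f (S.erase i) else 0 := rfl

theorem contract_apply (i : Fin 6) (f : Fock) (S : Finset (Fin 6)) :
    contract i f S = if i ∈ S then 0 else moveSign i S * f (insert i S) := rfl

/-- Clifford multiplication by the basis vectors of `ℂ¹² = ℂ⁶ ⊕ (ℂ⁶)^*`. -/
def gamma : Fin 6 ⊕ Fin 6 → Module.End ℂ Fock := Sum.elim wedge contract

/-- The spin representation `A ↦ ½ ∑ (A J)_{pq} γ_p γ_q`, where `J` is the matrix of the form,
on the whole exterior algebra. -/
def spin (A : Matrix (Fin 6 ⊕ Fin 6) (Fin 6 ⊕ Fin 6) ℂ) : Module.End ℂ Fock :=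
  (1 / 2 : ℂ) • ∑ p, ∑ q, A p q.swap • (gamma p * gamma q)

/-- The spinor pairing `β(s, t)`: up to the sign `(-1)^{∑_{i ∈ S} i}` (indices starting at `0`),
the coordinate at `S` is paired with the coordinate at the complement of `S`. -/
def pairing : Fock →ₗ[ℂ] Fock →ₗ[ℂ] ℂ :=
  LinearMap.mk₂ ℂ (fun s t => ∑ S : Finset (Fin 6), (-1) ^ (∑ i ∈ S, (i : ℕ)) * s S * t Sᶜ)
    (fun s s' t => by simp [mul_add, add_mul, Finset.sum_add_distrib])
    (fun c s t => by
      simp only [Fock.smul_apply, smul_eq_mul, Finset.mul_sum]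
      exact Finset.sum_congr rfl fun S _ => by ring)
    (fun s t t' => by simp [mul_add, Finset.sum_add_distrib])
    (fun c s t => by
      simp only [Fock.smul_apply, smul_eq_mul, Finset.mul_sum]
      exact Finset.sum_congr rfl fun S _ => by ring)

theorem moveSign_insert (i j : Fin 6) (S : Finset (Fin 6)) (h : i ∉ S) :
    moveSign j (insert i S) = (if i < j then -1 else 1) * moveSign j S := by
  unfold moveSign
  rw [Finset.filter_insert]
  split_ifs with hij
  · rw [Finset.card_insert_of_notMem (by simp [h]), pow_succ]; ring
  · simp

theorem moveSign_erase (i j : Fin 6) (S : Finset (Fin 6)) (h : i ∈ S) :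
    moveSign j (S.erase i) = (if i < j then -1 else 1) * moveSign j S := by
  conv_rhs => rw [← Finset.insert_erase h]
  rw [moveSign_insert _ _ _ (Finset.notMem_erase i S)]
  split_ifs <;> simp

theorem moveSign_sq (i : Fin 6) (S : Finset (Fin 6)) : moveSign i S * moveSign i S = 1 := by
  unfold moveSign
  rw [← mul_pow]; simp

/-- The Clifford relations. -/
theorem gamma_anticomm (p q : Fin 6 ⊕ Fin 6) :
    gamma p * gamma q + gamma q * gamma p = (if p.swap = q then 1 else 0 : ℂ) • 1 := by
  have ww : ∀ i j, wedge i * wedge j + wedge j * wedge i = 0 := by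
    intro i j
    refine LinearMap.ext fun f => Fock.ext fun S => ?_
    simp only [LinearMap.add_apply, Module.End.mul_apply, wedge_apply,
      Fock.add_apply, LinearMap.zero_apply, Fock.zero_apply, Finset.mem_erase]
    by_cases hij : i = j
    · subst hij; simp
    by_cases hi : i ∈ S <;> by_cases hj : j ∈ S <;> simp [hi, hj, hij, Ne.symm hij]
    rw [moveSign_erase _ _ _ hi, moveSign_erase _ _ _ hj, Finset.erase_right_comm]
    rcases lt_or_gt_of_ne hij with h | h
    · simp [h, h.not_gt]; ring
    · simp [h, h.not_gt]; ring
  have cc : ∀ i j, contract i * contract j + contract j * contract i = 0 := by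
    intro i j
    refine LinearMap.ext fun f => Fock.ext fun S => ?_
    simp only [LinearMap.add_apply, Module.End.mul_apply, contract_apply,
      Fock.add_apply, LinearMap.zero_apply, Fock.zero_apply, Finset.mem_insert]
    by_cases hij : i = j
    · subst hij; simp
    by_cases hi : i ∈ S <;> by_cases hj : j ∈ S <;> simp [hi, hj, hij, Ne.symm hij]
    rw [moveSign_insert _ _ _ hi, moveSign_insert _ _ _ hj, Finset.insert_comm]
    rcases lt_or_gt_of_ne hij with h | h
    · simp [h, h.not_gt]; ring
    · simp [h, h.not_gt]; ring
  have wc : ∀ i j, wedge i * contract j + contract j * wedge i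
      = (if i = j then 1 else 0 : ℂ) • 1 := by
    intro i j
    refine LinearMap.ext fun f => Fock.ext fun S => ?_
    simp only [LinearMap.add_apply, Module.End.mul_apply, contract_apply, wedge_apply,
      Fock.add_apply, Finset.mem_insert, Finset.mem_erase, LinearMap.smul_apply,
      Module.End.one_apply, Fock.smul_apply]
    by_cases hij : i = j
    · subst hij
      by_cases hi : i ∈ S
      · simp only [hi, if_true, ne_eq, not_true, false_and, if_false, Finset.insert_erase hi,
          add_zero, moveSign_erase _ _ _ hi, lt_irrefl, one_mul]
        rw [← mul_assoc, moveSign_sq]; ring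
      · simp only [hi, if_true, true_or, if_false, Finset.erase_insert hi,
          zero_add, moveSign_insert _ _ _ hi, lt_irrefl, one_mul]
        rw [← mul_assoc, moveSign_sq]; ring
    by_cases hi : i ∈ S <;> by_cases hj : j ∈ S <;> simp [hi, hj, hij, Ne.symm hij]
    rw [moveSign_erase _ _ _ hi, moveSign_insert _ _ _ hj, Finset.erase_insert_of_ne (Ne.symm hij)]
    rcases lt_or_gt_of_ne hij with h | h
    · simp [h, h.not_gt]; ring
    · simp [h, h.not_gt]; ring
  rcases p with i | i <;> rcases q with j | j
  · simpa [gamma] using ww i j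
  · simpa [gamma] using wc i j
  · simpa [gamma, add_comm, eq_comm] using wc j i
  · simpa [gamma] using cc i j

/-- The spin representation differentiates Clifford multiplication. -/
theorem spin_gamma (A : Matrix (Fin 6 ⊕ Fin 6) (Fin 6 ⊕ Fin 6) ℂ) (hA : A ∈ so12)
    (r : Fin 6 ⊕ Fin 6) :
    spin A * gamma r - gamma r * spin A = ∑ p, A p r • gamma p := by
  have key : ∀ p q : Fin 6 ⊕ Fin 6, gamma p * gamma q * gamma r - gamma r * (gamma p * gamma q)
      = (if q.swap = r then 1 else 0 : ℂ) • gamma p - (if p.swap = r then 1 else 0 : ℂ) • gamma q := by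
    intro p q
    have h1 := gamma_anticomm q r
    have h2 := gamma_anticomm p r
    have : gamma p * gamma q * gamma r - gamma r * (gamma p * gamma q)
      = gamma p * (gamma q * gamma r + gamma r * gamma q)
        - (gamma p * gamma r + gamma r * gamma p) * gamma q := by noncomm_ring
    rw [this, h1, h2]
    simp
  unfold spin
  rw [smul_mul_assoc, mul_smul_comm]
  rw [← smul_sub, Finset.sum_mul, Finset.mul_sum, ← Finset.sum_sub_distrib]
  have : ∀ p, (∑ q, A p q.swap • (gamma p * gamma q)) * gamma r
      - gamma r * (∑ q, A p q.swap • (gamma p * gamma q))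
      = A p r • gamma p - (if p.swap = r then 1 else 0 : ℂ) • ∑ q, A p q.swap • gamma q := by
    intro p
    rw [Finset.sum_mul, Finset.mul_sum, ← Finset.sum_sub_distrib]
    simp only [smul_mul_assoc, mul_smul_comm, ← smul_sub, key]
    simp only [smul_sub, Finset.sum_sub_distrib]
    congr 1
    · rw [Finset.sum_eq_single r.swap]
      · simp
      · intro b _ hb
        have : b.swap ≠ r := by rintro rfl; simp at hb
        simp [this]
      · simp
    · rw [Finset.smul_sum]
      refine Finset.sum_congr rfl fun q _ => ?_
      rw [smul_comm]
  rw [Finset.sum_congr rfl (fun p _ => this p), Finset.sum_sub_distrib]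
  have h2 : ∑ p : Fin 6 ⊕ Fin 6, (if p.swap = r then 1 else 0 : ℂ) • ∑ q, A p q.swap • gamma q
      = - ∑ p, A p r • gamma p := by
    rw [Finset.sum_eq_single r.swap]
    · rw [← Finset.sum_neg_distrib]
      simp only [Sum.swap_swap, if_true, one_smul]
      refine Finset.sum_congr rfl fun q _ => ?_
      rw [(mem_so12_iff A).1 hA r q.swap, neg_smul, Sum.swap_swap]
    · intro b _ hb
      have : b.swap ≠ r := by rintro rfl; simp at hb
      simp [this]
    · simp
  rw [h2, sub_neg_eq_add, ← two_smul ℂ, smul_smul]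
  norm_num

theorem pairing_apply (s t : Fock) :
    pairing s t = ∑ S : Finset (Fin 6), (-1) ^ (∑ i ∈ S, (i : ℕ)) * s S * t Sᶜ := rfl

theorem moveSign_compl (i : Fin 6) (S : Finset (Fin 6)) :
    moveSign i S * moveSign i Sᶜ = (-1) ^ (i : ℕ) := by
  unfold moveSign
  rw [← pow_add]
  congr 1
  rw [← Finset.card_union_of_disjoint, ← Finset.filter_union, Finset.union_compl]
  · simp [Finset.filter_gt_eq_Iio]
  · exact Finset.disjoint_filter_filter disjoint_compl_right

/-- The map adding or removing `i`. -/
def toggle (i : Fin 6) (S : Finset (Fin 6)) : Finset (Fin 6) :=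
  if i ∈ S then S.erase i else insert i S

theorem toggle_invol (i : Fin 6) : Function.Involutive (toggle i) := by
  intro S
  by_cases h : i ∈ S <;> simp [toggle, h]

theorem pairing_gamma (p : Fin 6 ⊕ Fin 6) (s t : Fock) :
    pairing (gamma p s) t = pairing s (gamma p t) := by
  have hc : ∀ (i : Fin 6) (S : Finset (Fin 6)), i ∉ S → (insert i S)ᶜ = Sᶜ.erase i := by
    intro i S _; simp
  have hs : ∀ (i : Fin 6) (S : Finset (Fin 6)), i ∉ S →
      (-1 : ℂ) ^ (∑ j ∈ insert i S, (j : ℕ)) = (-1) ^ (i : ℕ) * (-1) ^ (∑ j ∈ S, (j : ℕ)) := by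
    intro i S h; rw [Finset.sum_insert h, pow_add]
  have hm : ∀ (i : Fin 6) (S : Finset (Fin 6)),
      (-1) ^ (i : ℕ) * moveSign i S = moveSign i Sᶜ := by
    intro i S
    rw [← moveSign_compl i S, mul_right_comm, moveSign_sq, one_mul]
  rw [pairing_apply, pairing_apply]
  rcases p with i | i
  · rw [← Equiv.sum_comp (toggle_invol i).toPerm]
    refine Finset.sum_congr rfl fun S _ => ?_
    simp only [Function.Involutive.coe_toPerm, gamma, Sum.elim_inl, wedge_apply]
    by_cases h : i ∈ S
    · simp [toggle, h]
    · simp only [toggle, h, if_false, Finset.mem_insert_self, if_true, Finset.mem_compl,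
        not_false_eq_true, Finset.erase_insert h, hs i S h, hc i S h, moveSign_insert _ _ _ h,
        lt_irrefl, one_mul]
      rw [← hm]; ring
  · rw [← Equiv.sum_comp (toggle_invol i).toPerm]
    refine Finset.sum_congr rfl fun S _ => ?_
    simp only [Function.Involutive.coe_toPerm, gamma, Sum.elim_inr, contract_apply]
    by_cases h : i ∈ S
    · have h2 : insert i Sᶜ = (S.erase i)ᶜ := by
        ext j; simp
      have h3 := hs i (S.erase i) (by simp)
      rw [Finset.insert_erase h] at h3
      simp only [toggle, h, if_true, Finset.mem_erase, ne_eq, not_true, false_and, if_false,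
        Finset.insert_erase h, Finset.mem_compl, h2, h3, moveSign_erase _ _ _ h, lt_irrefl, one_mul]
      rw [← hm]
      have : ((-1 : ℂ) ^ (i : ℕ)) * (-1) ^ (i : ℕ) = 1 := by rw [← mul_pow]; simp
      linear_combination (-1 : ℂ) ^ (∑ x ∈ S.erase i, (x : ℕ)) * moveSign i S * s S
        * t (S.erase i)ᶜ * (-this)
    · simp [toggle, h]

theorem pairing_skew (s t : Fock) : pairing s t = - pairing t s := by
  rw [pairing_apply, pairing_apply, ← Equiv.sum_comp (Function.Involutive.toPerm _
    (compl_involutive (α := Finset (Fin 6)))), ← Finset.sum_neg_distrib]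
  refine Finset.sum_congr rfl fun S _ => ?_
  simp only [Function.Involutive.coe_toPerm, compl_compl]
  have h : (-1 : ℂ) ^ (∑ i ∈ S, (i : ℕ)) * (-1) ^ (∑ i ∈ Sᶜ, (i : ℕ)) = -1 := by
    rw [← pow_add, Finset.sum_add_sum_compl]
    have : ∑ i : Fin 6, (i : ℕ) = 15 := by decide
    rw [this]; norm_num
  have h2 : (-1 : ℂ) ^ (∑ i ∈ S, (i : ℕ)) * (-1) ^ (∑ i ∈ S, (i : ℕ)) = 1 := by
    rw [← mul_pow]; simp
  have h3 : (-1 : ℂ) ^ (∑ i ∈ Sᶜ, (i : ℕ)) = - (-1 : ℂ) ^ (∑ i ∈ S, (i : ℕ)) := by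
    linear_combination (-1 : ℂ) ^ (∑ i ∈ S, (i : ℕ)) * h - (-1 : ℂ) ^ (∑ i ∈ Sᶜ, (i : ℕ)) * h2
  rw [h3]; ring

theorem spin_apply (A : Matrix (Fin 6 ⊕ Fin 6) (Fin 6 ⊕ Fin 6) ℂ) (f : Fock) :
    spin A f = (1 / 2 : ℂ) • ∑ p, ∑ q, A p q.swap • gamma p (gamma q f) := by
  simp only [spin, LinearMap.smul_apply, LinearMap.sum_apply, Module.End.mul_apply]

theorem spin_add (A B : Matrix (Fin 6 ⊕ Fin 6) (Fin 6 ⊕ Fin 6) ℂ) :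
    spin (A + B) = spin A + spin B := by
  simp [spin, add_smul, Finset.sum_add_distrib]

theorem spin_smul (c : ℂ) (A : Matrix (Fin 6 ⊕ Fin 6) (Fin 6 ⊕ Fin 6) ℂ) :
    spin (c • A) = c • spin A := by
  simp only [spin, Matrix.smul_apply, smul_eq_mul, mul_smul, ← Finset.smul_sum]
  rw [smul_comm]

theorem spin_gamma_gamma (A : Matrix (Fin 6 ⊕ Fin 6) (Fin 6 ⊕ Fin 6) ℂ) (hA : A ∈ so12)
    (p q : Fin 6 ⊕ Fin 6) :
    spin A * (gamma p * gamma q) - (gamma p * gamma q) * spin A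
      = ∑ r, A r p • (gamma r * gamma q) + ∑ r, A r q • (gamma p * gamma r) := by
  have : spin A * (gamma p * gamma q) - (gamma p * gamma q) * spin A
      = (spin A * gamma p - gamma p * spin A) * gamma q
        + gamma p * (spin A * gamma q - gamma q * spin A) := by noncomm_ring
  rw [this, spin_gamma A hA, spin_gamma A hA, Finset.sum_mul, Finset.mul_sum]
  simp only [smul_mul_assoc, mul_smul_comm]

theorem spin_lie (A B : so12) : spin (⁅A, B⁆ : so12) = spin A * spin B - spin B * spin A := by
  have hA := (mem_so12_iff A.1).1 A.2
  have e : ((⁅A, B⁆ : so12) : Matrix (Fin 6 ⊕ Fin 6) (Fin 6 ⊕ Fin 6) ℂ)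
      = A.1 * B.1 - B.1 * A.1 := rfl
  rw [e]
  conv_rhs => rw [show spin B.1 = (1 / 2 : ℂ) • ∑ p, ∑ q, B.1 p q.swap • (gamma p * gamma q) from rfl]
  rw [mul_smul_comm, smul_mul_assoc, ← smul_sub, Finset.mul_sum, Finset.sum_mul,
    ← Finset.sum_sub_distrib, spin]
  congr 1
  have h1 : ∀ p, spin A.1 * ∑ q, B.1 p q.swap • (gamma p * gamma q)
      - (∑ q, B.1 p q.swap • (gamma p * gamma q)) * spin A.1
      = ∑ q, ∑ r, (B.1 p q.swap * A.1 r p) • (gamma r * gamma q)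
        + ∑ q, ∑ r, (B.1 p q.swap * A.1 r q) • (gamma p * gamma r) := by
    intro p
    rw [Finset.mul_sum, Finset.sum_mul, ← Finset.sum_sub_distrib, ← Finset.sum_add_distrib]
    refine Finset.sum_congr rfl fun q _ => ?_
    rw [mul_smul_comm, smul_mul_assoc, ← smul_sub, spin_gamma_gamma _ A.2, smul_add,
      Finset.smul_sum, Finset.smul_sum]
    simp only [smul_smul]
  rw [Finset.sum_congr rfl (fun p _ => h1 p), Finset.sum_add_distrib]
  have h2 : ∑ p, ∑ q, ∑ r, (B.1 p q.swap * A.1 r p) • (gamma r * gamma q)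
      = ∑ r, ∑ q, (A.1 * B.1) r q.swap • (gamma r * gamma q) := by
    rw [Finset.sum_comm, Finset.sum_congr rfl (fun q _ => Finset.sum_comm), Finset.sum_comm]
    refine Finset.sum_congr rfl fun r _ => Finset.sum_congr rfl fun q _ => ?_
    rw [← Finset.sum_smul, Matrix.mul_apply]
    congr 1
    exact Finset.sum_congr rfl fun _ _ => mul_comm _ _
  have h3 : ∑ p, ∑ q, ∑ r, (B.1 p q.swap * A.1 r q) • (gamma p * gamma r)
      = - ∑ p, ∑ r, (B.1 * A.1) p r.swap • (gamma p * gamma r) := by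
    rw [← Finset.sum_neg_distrib]
    refine Finset.sum_congr rfl fun p _ => ?_
    rw [Finset.sum_comm, ← Finset.sum_neg_distrib]
    refine Finset.sum_congr rfl fun r _ => ?_
    rw [← Finset.sum_smul, Matrix.mul_apply, ← neg_smul, ← Finset.sum_neg_distrib]
    congr 1
    rw [← Equiv.sum_comp (Equiv.sumComm (Fin 6) (Fin 6))]
    refine Finset.sum_congr rfl fun q _ => ?_
    have := hA r.swap q.swap
    simp only [Sum.swap_swap] at this
    simp only [Equiv.sumComm_apply, Sum.swap_swap]
    rw [this]; ring
  rw [h2, h3, ← sub_eq_add_neg, ← Finset.sum_sub_distrib]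
  refine Finset.sum_congr rfl fun p _ => ?_
  rw [← Finset.sum_sub_distrib]
  refine Finset.sum_congr rfl fun q _ => ?_
  rw [← sub_smul, Matrix.sub_apply]

theorem pairing_spin (A : Matrix (Fin 6 ⊕ Fin 6) (Fin 6 ⊕ Fin 6) ℂ) (hA : A ∈ so12) (s t : Fock) :
    pairing (spin A s) t = - pairing s (spin A t) := by
  have h := (mem_so12_iff A).1 hA
  simp only [spin, LinearMap.smul_apply, LinearMap.sum_apply, map_smul, map_sum,
    Module.End.mul_apply, pairing_gamma, smul_eq_mul]
  rw [← mul_neg, Finset.sum_comm, ← Finset.sum_neg_distrib]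
  congr 1
  refine Finset.sum_congr rfl fun p _ => ?_
  rw [← Finset.sum_neg_distrib]
  refine Finset.sum_congr rfl fun q _ => ?_
  have := h q.swap p.swap
  simp only [Sum.swap_swap] at this
  rw [this]; ring

/-- The even half-spin representation `Δ = ⨁ₖ ⋀²ᵏ ℂ⁶ = ℂ ⊕ ⋀² ⊕ ⋀⁴ ⊕ ⋀⁶`, of dimension `32`. -/
def HalfSpin : Submodule ℂ Fock where
  carrier := {f | ∀ S : Finset (Fin 6), ¬ Even S.card → f S = 0}
  add_mem' hf hg S hS := by simp [hf S hS, hg S hS]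
  zero_mem' S _ := rfl
  smul_mem' c f hf S hS := by simp [hf S hS]

theorem gamma_parity (p : Fin 6 ⊕ Fin 6) (f : Fock) (P : Prop)
    (hf : ∀ S : Finset (Fin 6), (Even S.card ↔ P) → f S = 0) (S : Finset (Fin 6))
    (hS : ¬ (Even S.card ↔ P)) : gamma p f S = 0 := by
  rcases p with i | i
  · simp only [gamma, Sum.elim_inl, wedge_apply]
    split_ifs with h
    · rw [hf, mul_zero]
      have := Finset.card_erase_add_one h
      rw [← this, Nat.even_add_one] at hS
      tauto
    · rfl
  · simp only [gamma, Sum.elim_inr, contract_apply]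
    split_ifs with h
    · rfl
    · rw [hf, mul_zero]
      rw [Finset.card_insert_of_notMem h, Nat.even_add_one]
      tauto

theorem gamma_gamma_mem (p q : Fin 6 ⊕ Fin 6) {f : Fock} (hf : f ∈ HalfSpin) :
    gamma p (gamma q f) ∈ HalfSpin := by
  intro S hS
  refine gamma_parity p _ True ?_ S (by simpa using hS)
  intro T hT
  refine gamma_parity q f False ?_ T (by simpa using hT)
  intro U hU
  exact hf U (by simpa using hU)

theorem spin_mem (A : Matrix (Fin 6 ⊕ Fin 6) (Fin 6 ⊕ Fin 6) ℂ) {f : Fock} (hf : f ∈ HalfSpin) :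
    spin A f ∈ HalfSpin := by
  simp only [spin, LinearMap.smul_apply, LinearMap.sum_apply, Module.End.mul_apply]
  exact Submodule.smul_mem _ _ (Submodule.sum_mem _ fun p _ => Submodule.sum_mem _ fun q _ =>
    Submodule.smul_mem _ _ (gamma_gamma_mem p q hf))

instance : LieRingModule so12 HalfSpin where
  bracket A s := ⟨spin A s, spin_mem A s.2⟩
  add_lie A B s := by ext1; simp [spin_add]
  lie_add A s t := by ext1; simp
  leibniz_lie A B s := by
    ext1
    change spin A (spin B s) = spin (⁅A, B⁆ : so12) s + spin B (spin A s)
    rw [spin_lie]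
    simp

instance : LieModule ℂ so12 HalfSpin where
  smul_lie c A s := by
    ext1
    change spin (c • A.1) s = c • spin A.1 s
    rw [spin_smul]; rfl
  lie_smul c A s := by
    ext1
    exact map_smul (spin A.1) c s.1

theorem coe_lie (A : so12) (s : HalfSpin) : ((⁅A, s⁆ : HalfSpin) : Fock) = spin A s := rfl

/-- The symmetric map `Sym² Δ → 𝔰𝔬₁₂` dual to `(s, t) ↦ β(A s, t)`: its matrix entries are
`β([γ_{p^*}, γ_q] s, t)`, where `γ_{p^*}` is dual to `γ_p`. -/
def moment : Fock →ₗ[ℂ] Fock →ₗ[ℂ] Matrix (Fin 6 ⊕ Fin 6) (Fin 6 ⊕ Fin 6) ℂ :=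
  LinearMap.mk₂ ℂ
    (fun s t => Matrix.of fun p q =>
      pairing ((gamma p.swap * gamma q - gamma q * gamma p.swap) s) t)
    (fun s s' t => by ext p q; simp only [Matrix.of_apply, Matrix.add_apply, map_add,
      LinearMap.add_apply])
    (fun c s t => by ext p q; simp only [Matrix.of_apply, Matrix.smul_apply, map_smul,
      LinearMap.smul_apply])
    (fun s t t' => by ext p q; simp only [Matrix.of_apply, Matrix.add_apply, map_add])
    (fun c s t => by ext p q; simp only [Matrix.of_apply, Matrix.smul_apply, map_smul])

theorem moment_apply (s t : Fock) (p q : Fin 6 ⊕ Fin 6) :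
    moment s t p q = pairing ((gamma p.swap * gamma q - gamma q * gamma p.swap) s) t := rfl

theorem moment_mem (s t : Fock) : moment s t ∈ so12 := by
  rw [mem_so12_iff]
  intro p q
  rw [moment_apply, moment_apply, Sum.swap_swap, Sum.swap_swap,
    ← neg_sub (gamma q * gamma p), LinearMap.neg_apply, map_neg, LinearMap.neg_apply]

theorem moment_symm (s t : Fock) : moment s t = moment t s := by
  ext p q
  rw [moment_apply, moment_apply, pairing_skew]
  simp only [LinearMap.sub_apply, Module.End.mul_apply, map_sub, pairing_gamma]
  ring

theorem moment_equivariant (A : Matrix (Fin 6 ⊕ Fin 6) (Fin 6 ⊕ Fin 6) ℂ) (hA : A ∈ so12)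
    (s t : Fock) :
    A * moment s t - moment s t * A = moment (spin A s) t + moment s (spin A t) := by
  have h := (mem_so12_iff A).1 hA
  ext p q
  have key : spin A * (gamma p.swap * gamma q - gamma q * gamma p.swap)
      - (gamma p.swap * gamma q - gamma q * gamma p.swap) * spin A
      = ∑ r, A r p.swap • (gamma r * gamma q - gamma q * gamma r)
        + ∑ r, A r q • (gamma p.swap * gamma r - gamma r * gamma p.swap) := by
    have h1 := spin_gamma_gamma A hA p.swap q
    have h2 := spin_gamma_gamma A hA q p.swap
    simp only [smul_sub, Finset.sum_sub_distrib]
    have e : spin A * (gamma p.swap * gamma q - gamma q * gamma p.swap)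
        - (gamma p.swap * gamma q - gamma q * gamma p.swap) * spin A
        = (spin A * (gamma p.swap * gamma q) - (gamma p.swap * gamma q) * spin A)
          - (spin A * (gamma q * gamma p.swap) - (gamma q * gamma p.swap) * spin A) := by
      noncomm_ring
    rw [e, h1, h2]
    abel
  have e1 : moment (spin A s) t p q + moment s (spin A t) p q
      = - pairing ((spin A * (gamma p.swap * gamma q - gamma q * gamma p.swap)
      - (gamma p.swap * gamma q - gamma q * gamma p.swap) * spin A) s) t := by
    rw [moment_apply, moment_apply]
    have := pairing_spin A hA ((gamma p.swap * gamma q - gamma q * gamma p.swap) s) t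
    generalize gamma p.swap * gamma q - gamma q * gamma p.swap = C at this ⊢
    rw [LinearMap.sub_apply, map_sub, LinearMap.sub_apply, Module.End.mul_apply,
      Module.End.mul_apply, this]
    ring
  rw [Matrix.add_apply, e1, key]
  simp only [LinearMap.add_apply, LinearMap.sum_apply, LinearMap.smul_apply, map_add, map_sum,
    map_smul, smul_eq_mul]
  rw [Matrix.sub_apply, Matrix.mul_apply, Matrix.mul_apply, neg_add, sub_eq_add_neg]
  congr 1
  · rw [← Equiv.sum_comp (Equiv.sumComm (Fin 6) (Fin 6)), ← Finset.sum_neg_distrib]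
    refine Finset.sum_congr rfl fun r _ => ?_
    have := h r.swap p.swap
    simp only [Sum.swap_swap] at this
    simp only [Equiv.sumComm_apply, moment_apply, Sum.swap_swap]
    rw [this]; ring
  · rw [← Finset.sum_neg_distrib, ← Finset.sum_neg_distrib]
    refine Finset.sum_congr rfl fun r _ => ?_
    rw [moment_apply]; ring

theorem spin_moment_comm (A : Matrix (Fin 6 ⊕ Fin 6) (Fin 6 ⊕ Fin 6) ℂ) (hA : A ∈ so12)
    (r s t : Fock) :
    spin A (spin (moment r s) t) = spin (moment (spin A r) s) t + spin (moment r (spin A s)) t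
      + spin (moment r s) (spin A t) := by
  have h := spin_lie ⟨A, hA⟩ ⟨moment r s, moment_mem r s⟩
  have e : ((⁅(⟨A, hA⟩ : so12), (⟨moment r s, moment_mem r s⟩ : so12)⁆ : so12) :
      Matrix (Fin 6 ⊕ Fin 6) (Fin 6 ⊕ Fin 6) ℂ) = A * moment r s - moment r s * A := rfl
  rw [e, moment_equivariant A hA, spin_add] at h
  have h2 := congrArg (fun F : Module.End ℂ Fock => F t) h
  simp only [LinearMap.add_apply, LinearMap.sub_apply, Module.End.mul_apply] at h2
  rw [h2]; abel

/-- The defect of the cubic identity satisfied by `moment` and `pairing`. -/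
def defect (r s t : Fock) : Fock :=
  spin (moment r s) t - spin (moment r t) s
    - ((2 * pairing s t) • r + pairing r t • s - pairing r s • t)

theorem defect_equivariant (A : Matrix (Fin 6 ⊕ Fin 6) (Fin 6 ⊕ Fin 6) ℂ) (hA : A ∈ so12)
    (r s t : Fock) :
    spin A (defect r s t) = defect (spin A r) s t + defect r (spin A s) t
      + defect r s (spin A t) := by
  unfold defect
  simp only [map_sub, map_add, map_smul, spin_moment_comm A hA, pairing_spin A hA]
  module

theorem defect_add_left (r r' s t : Fock) :
    defect (r + r') s t = defect r s t + defect r' s t := by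
  unfold defect
  simp only [map_add, LinearMap.add_apply, spin_add]
  module

theorem defect_smul_left (c : ℂ) (r s t : Fock) :
    defect (c • r) s t = c • defect r s t := by
  unfold defect
  simp only [map_smul, LinearMap.smul_apply, spin_smul, smul_eq_mul]
  module

theorem defect_add_mid (r s s' t : Fock) :
    defect r (s + s') t = defect r s t + defect r s' t := by
  unfold defect
  simp only [map_add, LinearMap.add_apply, spin_add]
  module

theorem defect_smul_mid (c : ℂ) (r s t : Fock) :
    defect r (c • s) t = c • defect r s t := by
  unfold defect
  simp only [map_smul, LinearMap.smul_apply, spin_smul, smul_eq_mul]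
  module

/-- The basis vector of the exterior algebra attached to `S`. -/
def basisVec (S : Finset (Fin 6)) : Fock := fun T => if T = S then 1 else 0

theorem basisVec_apply (S T : Finset (Fin 6)) : basisVec S T = if T = S then 1 else 0 := rfl

theorem basisVec_mem {S : Finset (Fin 6)} (h : Even S.card) : basisVec S ∈ HalfSpin := by
  intro T hT
  rw [basisVec_apply, if_neg]
  rintro rfl; exact hT h

theorem wedge_basisVec {i : Fin 6} {S : Finset (Fin 6)} (h : i ∉ S) :
    wedge i (basisVec S) = moveSign i S • basisVec (insert i S) := by
  ext T
  simp only [wedge_apply, Fock.smul_apply, basisVec_apply]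
  by_cases hT : T = insert i S
  · subst hT; simp [h, moveSign_insert _ _ _ h]
  · by_cases hi : i ∈ T
    · have : T.erase i ≠ S := by rintro rfl; exact hT (Finset.insert_erase hi).symm
      simp [hi, hT, this]
    · simp [hi, hT]

theorem contract_basisVec {i : Fin 6} {S : Finset (Fin 6)} (h : i ∉ S) :
    contract i (basisVec (insert i S)) = moveSign i S • basisVec S := by
  ext T
  simp only [contract_apply, Fock.smul_apply, basisVec_apply]
  by_cases hT : T = S
  · subst hT; simp [h]
  · by_cases hi : i ∈ T
    · simp [hi, hT]
    · have : insert i T ≠ insert i S := by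
        intro e
        apply hT
        rw [← Finset.erase_insert hi, e, Finset.erase_insert h]
      simp [hi, hT, this]

theorem moveSign_ne_zero (i : Fin 6) (S : Finset (Fin 6)) : moveSign i S ≠ 0 := by
  unfold moveSign
  exact pow_ne_zero _ (by norm_num)

theorem halfSpin_le (W : Submodule ℂ Fock)
    (h : ∀ S : Finset (Fin 6), Even S.card → basisVec S ∈ W) : HalfSpin ≤ W := by
  intro f hf
  have : f = ∑ S : Finset (Fin 6), f S • basisVec S := by
    ext T
    have : (∑ S : Finset (Fin 6), f S • basisVec S) T
        = ∑ S : Finset (Fin 6), (f S • basisVec S) T :=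
      Finset.sum_apply T Finset.univ (fun S => f S • basisVec S)
    rw [this, Finset.sum_eq_single T]
    · simp [basisVec_apply]
    · intro S _ hS; simp [basisVec_apply, Ne.symm hS]
    · simp
  rw [this]
  refine Submodule.sum_mem _ fun S _ => ?_
  by_cases hS : Even S.card
  · exact Submodule.smul_mem _ _ (h S hS)
  · rw [hf S hS, zero_smul]; exact W.zero_mem

theorem exists_pair {S : Finset (Fin 6)} (h : Even S.card) (h0 : S ≠ ∅) :
    ∃ i j T, i ∉ T ∧ j ∉ insert i T ∧ S = insert j (insert i T) := by
  obtain ⟨j, hj⟩ := Finset.nonempty_iff_ne_empty.2 h0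
  have h1 : (S.erase j).Nonempty := by
    rw [← Finset.card_pos, Finset.card_erase_of_mem hj]
    have : 0 < S.card := Finset.card_pos.2 ⟨j, hj⟩
    obtain ⟨k, hk⟩ := h
    omega
  obtain ⟨i, hi⟩ := h1
  refine ⟨i, j, (S.erase j).erase i, by simp, ?_, ?_⟩
  · rw [Finset.insert_erase hi]; simp
  · rw [Finset.insert_erase hi, Finset.insert_erase hj]

theorem halfSpin_le_of_wedge (W : Submodule ℂ Fock) (h0 : basisVec ∅ ∈ W)
    (h : ∀ i j f, f ∈ W → wedge i (wedge j f) ∈ W) : HalfSpin ≤ W := by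
  refine halfSpin_le W fun S => ?_
  induction hn : S.card using Nat.strong_induction_on generalizing S with
  | _ n ih =>
    intro hS
    by_cases hS0 : S = ∅
    · rw [hS0]; exact h0
    obtain ⟨i, j, T, hi, hj, rfl⟩ := exists_pair (hn ▸ hS) hS0
    have hc : (insert j (insert i T)).card = T.card + 2 := by
      rw [Finset.card_insert_of_notMem hj, Finset.card_insert_of_notMem hi]
    have hT := ih T.card (by omega) T rfl (by
      have : Even (T.card + 2) := by rw [← hc, hn]; exact hS
      simpa [Nat.even_add] using this)
    have h2 := h j i _ hT
    rw [wedge_basisVec hi, map_smul, wedge_basisVec hj] at h2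
    rwa [Submodule.smul_mem_iff _ (moveSign_ne_zero _ _),
      Submodule.smul_mem_iff _ (moveSign_ne_zero _ _)] at h2

theorem halfSpin_le_of_contract (W : Submodule ℂ Fock) (h0 : basisVec Finset.univ ∈ W)
    (h : ∀ i j f, f ∈ W → contract i (contract j f) ∈ W) : HalfSpin ≤ W := by
  have hcompl : ∀ S : Finset (Fin 6), S.card + Sᶜ.card = 6 := fun S => by
    simpa using Finset.card_add_card_compl S
  refine halfSpin_le W fun S => ?_
  induction hn : Sᶜ.card using Nat.strong_induction_on generalizing S with
  | _ n ih =>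
    intro hS
    have hce : Even Sᶜ.card := by
      have := hcompl S
      obtain ⟨k, hk⟩ := hS
      exact ⟨3 - k, by omega⟩
    by_cases hS0 : Sᶜ = ∅
    · rw [Finset.compl_eq_empty_iff] at hS0; rw [hS0]; exact h0
    obtain ⟨i, j, T, hi, hj, hST⟩ := exists_pair hce hS0
    have hiS : i ∉ S := by rw [← Finset.mem_compl, hST]; simp
    have hjS : j ∉ insert i S := by
      have h1 : j ∉ S := by rw [← Finset.mem_compl, hST]; simp
      have h2 : j ≠ i := by rintro rfl; simp at hj
      simp [h1, h2]
    have hc : (insert j (insert i S)).card = S.card + 2 := by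
      rw [Finset.card_insert_of_notMem hjS, Finset.card_insert_of_notMem hiS]
    have h1 := hcompl S
    have h2 := hcompl (insert j (insert i S))
    have hT := ih (insert j (insert i S))ᶜ.card (by omega) _ rfl (by
      rw [hc]; exact hS.add even_two)
    have h3 := h i j _ hT
    rw [contract_basisVec hjS, map_smul, contract_basisVec hiS] at h3
    rwa [Submodule.smul_mem_iff _ (moveSign_ne_zero _ _),
      Submodule.smul_mem_iff _ (moveSign_ne_zero _ _)] at h3

/-- The element of `𝔰𝔬₁₂` acting on spinors as `½ (γ_p γ_q - γ_q γ_p)`. -/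
def bivector (p q : Fin 6 ⊕ Fin 6) : Matrix (Fin 6 ⊕ Fin 6) (Fin 6 ⊕ Fin 6) ℂ :=
  Matrix.of fun a b => (if a = p ∧ b.swap = q then 1 else 0) - (if a = q ∧ b.swap = p then 1 else 0)

theorem bivector_mem (p q : Fin 6 ⊕ Fin 6) : bivector p q ∈ so12 := by
  rw [mem_so12_iff]
  intro a b
  simp only [bivector, Matrix.of_apply]
  rw [neg_sub]
  simp only [and_comm]

theorem spin_bivector (p q : Fin 6 ⊕ Fin 6) :
    spin (bivector p q) = (1 / 2 : ℂ) • (gamma p * gamma q - gamma q * gamma p) := by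
  unfold spin bivector
  congr 1
  simp only [Matrix.of_apply, Sum.swap_swap, sub_smul, Finset.sum_sub_distrib, ite_smul, one_smul,
    zero_smul]
  congr 1
  · rw [Finset.sum_eq_single p, Finset.sum_eq_single q] <;> simp +contextual
  · rw [Finset.sum_eq_single q, Finset.sum_eq_single p] <;> simp +contextual

theorem spin_bivector_inl (i j : Fin 6) :
    spin (bivector (.inl i) (.inl j)) = wedge i * wedge j := by
  have h := gamma_anticomm (.inl i) (.inl j)
  rw [spin_bivector]
  simp only [gamma, Sum.elim_inl, Sum.swap_inl, reduceCtorEq, if_false, zero_smul] at h ⊢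
  rw [eq_neg_of_add_eq_zero_right h]
  module

theorem spin_bivector_inr (i j : Fin 6) :
    spin (bivector (.inr i) (.inr j)) = contract i * contract j := by
  have h := gamma_anticomm (.inr i) (.inr j)
  rw [spin_bivector]
  simp only [gamma, Sum.elim_inr, Sum.swap_inr, reduceCtorEq, if_false, zero_smul] at h ⊢
  rw [eq_neg_of_add_eq_zero_right h]
  module

theorem basisVec_self (S : Finset (Fin 6)) : basisVec S S = 1 := by simp [basisVec]

theorem contract_vac (i : Fin 6) : contract i (basisVec ∅) = 0 := by
  ext T
  simp [contract_apply, basisVec_apply]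

theorem wedge_top (i : Fin 6) : wedge i (basisVec Finset.univ) = 0 := by
  ext T
  rw [wedge_apply]
  split_ifs with h
  · have : T.erase i ≠ Finset.univ := fun e => by
      have := Finset.notMem_erase i T
      rw [e] at this; exact this (Finset.mem_univ i)
    simp [basisVec_apply, this]
  · rfl

theorem pairing_vac (t : Fock) : pairing (basisVec ∅) t = t Finset.univ := by
  rw [pairing_apply, Finset.sum_eq_single ∅]
  · simp [basisVec_apply]
  · intro S _ hS; simp [basisVec_apply, hS]
  · simp

theorem pairing_top (t : Fock) : pairing (basisVec Finset.univ) t = - t ∅ := by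
  rw [pairing_apply, Finset.sum_eq_single Finset.univ]
  · have : ∑ i : Fin 6, (i : ℕ) = 15 := by decide
    simp [basisVec_apply, this]; norm_num
  · intro S _ hS; simp [basisVec_apply, hS]
  · simp

theorem number_apply (i : Fin 6) (f : Fock) (L : Finset (Fin 6)) :
    wedge i (contract i f) L = if i ∈ L then f L else 0 := by
  rw [wedge_apply]
  split_ifs with h
  · rw [contract_apply, if_neg (by simp), Finset.insert_erase h, moveSign_erase _ _ _ h, if_neg
      (lt_irrefl _), one_mul, ← mul_assoc, moveSign_sq, one_mul]
  · rfl

theorem spin_moment_vac (t f : Fock) :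
    spin (moment (basisVec ∅) t) f
      = ∑ i, ∑ j, (wedge j (wedge i t) Finset.univ) • contract i (contract j f)
        + t Finset.univ • (∑ i, wedge i (contract i f) - (3 : ℂ) • f) := by
  have hcw : ∀ i j (g : Fock), contract i (wedge j g)
      = (if i = j then 1 else 0 : ℂ) • g - wedge j (contract i g) := by
    intro i j g
    have h := gamma_anticomm (.inr i) (.inl j)
    have h2 := congrArg (fun F : Module.End ℂ Fock => F g) h
    simp only [gamma, Sum.elim_inl, Sum.elim_inr, LinearMap.add_apply, Module.End.mul_apply,
      Sum.swap_inr, Sum.inl.injEq, LinearMap.smul_apply, Module.End.one_apply] at h2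
    rw [← h2]; abel
  have hww : ∀ i j (g : Fock), wedge i (wedge j g) = - wedge j (wedge i g) := by
    intro i j g
    have h := gamma_anticomm (.inl i) (.inl j)
    have h2 := congrArg (fun F : Module.End ℂ Fock => F g) h
    simp only [gamma, Sum.elim_inl, LinearMap.add_apply, Module.End.mul_apply,
      Sum.swap_inl, reduceCtorEq, if_false, zero_smul, LinearMap.zero_apply] at h2
    exact eq_neg_of_add_eq_zero_left h2
  have hp : ∀ i j, pairing (wedge i (wedge j (basisVec ∅))) t = wedge j (wedge i t) Finset.univ := by
    intro i j
    have h1 := pairing_gamma (.inl i) (wedge j (basisVec ∅)) t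
    have h2 := pairing_gamma (.inl j) (basisVec ∅) (wedge i t)
    simp only [gamma, Sum.elim_inl] at h1 h2
    rw [h1, h2, pairing_vac]
  have e : ∀ a b : Fin 6 ⊕ Fin 6, moment (basisVec ∅) t a b.swap
      = pairing (gamma a.swap (gamma b.swap (basisVec ∅))) t
        - pairing (gamma b.swap (gamma a.swap (basisVec ∅))) t := by
    intro a b
    rw [moment_apply]
    simp
  have ew : ∀ i j, wedge i (wedge j t) Finset.univ = - wedge j (wedge i t) Finset.univ := by
    intro i j; rw [hww]; rfl
  have m1 : ∀ i j, moment (basisVec ∅) t (.inl i) (Sum.inl j).swap = 0 := by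
    intro i j
    rw [e]; simp [gamma, contract_vac]
  have m2 : ∀ i j, moment (basisVec ∅) t (.inl i) (Sum.inr j).swap
      = (if i = j then t Finset.univ else 0) := by
    intro i j
    rw [e]
    simp only [gamma, Sum.swap_inl, Sum.swap_inr, Sum.elim_inl, Sum.elim_inr, contract_vac, hcw,
      map_zero, sub_zero, map_smul, LinearMap.smul_apply, pairing_vac, LinearMap.zero_apply]
    simp
  have m3 : ∀ i j, moment (basisVec ∅) t (.inr i) (Sum.inl j).swap
      = - (if i = j then t Finset.univ else 0) := by
    intro i j
    rw [e]
    simp only [gamma, Sum.swap_inl, Sum.swap_inr, Sum.elim_inl, Sum.elim_inr, contract_vac, hcw,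
      map_zero, sub_zero, map_smul, LinearMap.smul_apply, pairing_vac, LinearMap.zero_apply]
    simp [eq_comm]
  have m4 : ∀ i j, moment (basisVec ∅) t (.inr i) (Sum.inr j).swap
      = 2 * wedge j (wedge i t) Finset.univ := by
    intro i j
    rw [e]
    simp only [gamma, Sum.swap_inr, Sum.elim_inl, hp]
    rw [ew i j]; ring
  rw [spin_apply]
  simp only [Fintype.sum_sum_type, m1, m2, m3, m4, zero_smul, Finset.sum_const_zero, zero_add,
    neg_smul, ite_smul, Finset.sum_neg_distrib, Finset.sum_ite_eq, Finset.mem_univ, if_true,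
    gamma, Sum.elim_inl, Sum.elim_inr, Finset.sum_add_distrib, hcw, smul_sub, one_smul,
    Finset.sum_sub_distrib, mul_smul, ← Finset.smul_sum, Finset.sum_const, Finset.card_univ,
    Fintype.card_fin]
  module

theorem moveSign_pair (i j : Fin 6) (h : i ≠ j) (L : Finset (Fin 6))
    (hL : L = (Finset.univ.erase j).erase i) (t : Fock) :
    wedge j (wedge i t) Finset.univ * contract i (contract j (basisVec Finset.univ)) L = t L := by
  have h1 : i ∉ L := by simp [hL]
  have h2 : insert i L = Finset.univ.erase j := by
    rw [hL, Finset.insert_erase]; simp [h]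
  have h3 : i ∈ Finset.univ.erase j := by simp [h]
  rw [wedge_apply, wedge_apply, contract_apply, contract_apply, if_pos (Finset.mem_univ j),
    if_pos h3, if_neg h1, h2, if_neg (by simp), Finset.insert_erase (Finset.mem_univ j),
    basisVec_self, ← hL, moveSign_erase j j _ (Finset.mem_univ j)]
  have h4 : moveSign i L = moveSign i (Finset.univ.erase j) := by
    rw [hL, moveSign_erase i i _ h3]; simp
  have e1 := moveSign_sq j Finset.univ
  have e2 := moveSign_sq i (Finset.univ.erase j)
  rw [h4]
  simp only [lt_irrefl, if_false, one_mul, mul_one]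
  linear_combination (t L * moveSign i (Finset.univ.erase j) * moveSign i (Finset.univ.erase j)) * e1
    + t L * e2

theorem moveSign_pair' (i j : Fin 6) (L : Finset (Fin 6))
    (t : Fock) :
    wedge j (wedge i t) Finset.univ * contract i (contract j (basisVec Finset.univ)) L
      = if i ≠ j ∧ L = (Finset.univ.erase j).erase i then t L else 0 := by
  split_ifs with h
  · exact moveSign_pair i j h.1 L h.2 t
  · by_cases hij : i = j
    · subst hij
      rw [wedge_apply, wedge_apply]; simp
    · have hL : L ≠ (Finset.univ.erase j).erase i := fun e => h ⟨hij, e⟩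
      rw [contract_apply, contract_apply]
      by_cases h1 : i ∈ L
      · simp [h1]
      by_cases h2 : j ∈ insert i L
      · simp [h2]
      have : insert j (insert i L) ≠ Finset.univ := by
        intro e
        apply hL
        rw [← e, Finset.erase_insert h2, Finset.erase_insert h1]
      simp [h1, h2, basisVec_apply, this]

theorem count_aux : ∀ a b : Fin 6, a ≠ b → (∑ i : Fin 6, ∑ j : Fin 6,
    if (i = a ∧ j = b) ∨ (i = b ∧ j = a) then 1 else 0) = 2 := by
  decide

theorem count_pairs (L : Finset (Fin 6)) : (∑ i : Fin 6, ∑ j : Fin 6,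
    if i ≠ j ∧ L = (Finset.univ.erase j).erase i then 1 else 0) = if L.card = 4 then 2 else 0 := by
  have e : ∀ i j : Fin 6, (Finset.univ.erase j).erase i = ({i, j} : Finset (Fin 6))ᶜ := by
    intro i j; ext k; simp
  have hc := Finset.card_add_card_compl L
  rw [Fintype.card_fin] at hc
  split_ifs with h
  · obtain ⟨a, b, hab, hL⟩ := Finset.card_eq_two.1 (show Lᶜ.card = 2 by omega)
    rw [← count_aux a b hab]
    refine Finset.sum_congr rfl fun i _ => Finset.sum_congr rfl fun j _ => ?_
    refine if_congr ?_ rfl rfl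
    rw [e, ← compl_inj_iff, compl_compl, hL]
    constructor
    · rintro ⟨hij, h⟩
      have hi : i ∈ ({a, b} : Finset (Fin 6)) := by rw [h]; simp
      have hj : j ∈ ({a, b} : Finset (Fin 6)) := by rw [h]; simp
      simp only [Finset.mem_insert, Finset.mem_singleton] at hi hj
      rcases hi with rfl | rfl <;> rcases hj with rfl | rfl <;> simp_all
    · rintro (⟨rfl, rfl⟩ | ⟨rfl, rfl⟩)
      · exact ⟨hab, rfl⟩
      · exact ⟨hab.symm, Finset.pair_comm _ _⟩
  · refine Finset.sum_eq_zero fun i _ => Finset.sum_eq_zero fun j _ => if_neg ?_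
    rintro ⟨hij, hL⟩
    rw [e, ← compl_inj_iff, compl_compl] at hL
    rw [hL, Finset.card_pair hij] at hc
    omega

theorem fock_sum_apply {ι : Type*} (I : Finset ι) (F : ι → Fock) (S : Finset (Fin 6)) :
    (∑ i ∈ I, F i) S = ∑ i ∈ I, F i S :=
  Finset.sum_apply S I F

theorem defect_vac_top (t : Fock) (ht : t ∈ HalfSpin) :
    defect (basisVec ∅) (basisVec Finset.univ) t = 0 := by
  ext L
  unfold defect
  rw [spin_moment_vac, spin_moment_vac, pairing_top, pairing_vac, pairing_vac]
  simp only [wedge_top, map_zero, Fock.zero_apply, zero_smul, Finset.sum_const_zero, zero_add,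
    Fock.sub_apply, Fock.add_apply, Fock.smul_apply, fock_sum_apply, number_apply,
    moveSign_pair', basisVec_self, one_mul]
  have e1 : ∀ f : Fock, ∑ x, (if x ∈ L then f L else 0) = L.card * f L := by
    intro f; simp
  have e2 : (∑ i : Fin 6, ∑ j : Fin 6,
      if i ≠ j ∧ L = (Finset.univ.erase j).erase i then t L else 0)
      = (if L.card = 4 then 2 else 0) * t L := by
    have := congrArg (fun n : ℕ => (n : ℂ) * t L) (count_pairs L)
    simp only [Nat.cast_sum, Nat.cast_ite, Finset.sum_mul, ite_mul, Nat.cast_one, Nat.cast_zero,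
      one_mul, zero_mul, Nat.cast_ofNat] at this ⊢
    exact this
  rw [e1, e1, e2]
  by_cases hL : Even L.card
  · have h6 : L.card ≤ 6 := by simpa using Finset.card_le_univ L
    have hu : L.card = 6 ↔ L = Finset.univ := by
      rw [← Finset.card_eq_iff_eq_univ]; simp
    have hc : L.card = 0 ∨ L.card = 2 ∨ L.card = 4 ∨ L.card = 6 := by
      obtain ⟨k, hk⟩ := hL; omega
    rcases hc with h | h | h | h
    · rw [Finset.card_eq_zero] at h
      subst h
      simp [basisVec_apply, Finset.univ_nonempty.ne_empty.symm]; ring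
    · have h1 : L ≠ ∅ := by rintro rfl; simp at h
      have h2 : L ≠ Finset.univ := by rw [ne_eq, ← hu]; omega
      simp [h, basisVec_apply, h1, h2]; ring
    · have h1 : L ≠ ∅ := by rintro rfl; simp at h
      have h2 : L ≠ Finset.univ := by rw [ne_eq, ← hu]; omega
      simp [h, basisVec_apply, h1, h2]; ring
    · have h1 : L ≠ ∅ := by rintro rfl; simp at h
      have h2 := hu.1 h
      subst h2
      simp [basisVec_apply, h1]; ring
  · have h1 : L ≠ ∅ := by rintro rfl; simp at hL
    have h2 : L ≠ Finset.univ := by rintro rfl; exact hL (by decide)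
    simp [ht L hL, basisVec_apply, h1, h2]

theorem defect_vac (s t : Fock) (hs : s ∈ HalfSpin) (ht : t ∈ HalfSpin) :
    defect (basisVec ∅) s t = 0 := by
  let W : Submodule ℂ Fock :=
    { carrier := {s | ∀ t ∈ HalfSpin, defect (basisVec ∅) s t = 0}
      add_mem' := fun {a b} ha hb t ht => by rw [defect_add_mid, ha t ht, hb t ht, add_zero]
      zero_mem' := fun t _ => by
        have := defect_smul_mid 0 (basisVec ∅) 0 t
        rwa [zero_smul, zero_smul] at this
      smul_mem' := fun c a ha t ht => by rw [defect_smul_mid, ha t ht, smul_zero] }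
  have hW : HalfSpin ≤ W := by
    refine halfSpin_le_of_contract W defect_vac_top ?_
    intro i j f hf t ht
    have h := defect_equivariant _ (bivector_mem (.inr i) (.inr j)) (basisVec ∅) f t
    rw [hf t ht, hf _ (spin_mem _ ht), spin_bivector_inr, Module.End.mul_apply,
      Module.End.mul_apply, contract_vac, map_zero, map_zero, add_zero] at h
    have h0 := defect_smul_left 0 0 f t
    rw [zero_smul, zero_smul] at h0
    rw [h0, zero_add] at h
    exact h.symm
  exact hW hs t ht

/-- The cubic identity on `Δ` behind the Jacobi identity of `𝔢₇`. -/
theorem moment_identity (r s t : Fock) (hr : r ∈ HalfSpin) (hs : s ∈ HalfSpin)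
    (ht : t ∈ HalfSpin) :
    spin (moment r s) t - spin (moment r t) s
      = (2 * pairing s t) • r + pairing r t • s - pairing r s • t := by
  let W : Submodule ℂ Fock :=
    { carrier := {r | ∀ s ∈ HalfSpin, ∀ t ∈ HalfSpin, defect r s t = 0}
      add_mem' := fun {a b} ha hb s hs t ht => by
        rw [defect_add_left, ha s hs t ht, hb s hs t ht, add_zero]
      zero_mem' := fun s _ t _ => by
        have := defect_smul_left 0 0 s t
        rwa [zero_smul, zero_smul] at this
      smul_mem' := fun c a ha s hs t ht => by rw [defect_smul_left, ha s hs t ht, smul_zero] }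
  have hW : HalfSpin ≤ W := by
    refine halfSpin_le_of_wedge W (fun s hs t ht => defect_vac s t hs ht) ?_
    intro i j f hf s hs t ht
    have h := defect_equivariant _ (bivector_mem (.inl i) (.inl j)) f s t
    rw [hf s hs t ht, hf _ (spin_mem _ hs) t ht, hf s hs _ (spin_mem _ ht), spin_bivector_inl,
      Module.End.mul_apply, map_zero, map_zero, add_zero, add_zero] at h
    exact h.symm
  exact sub_eq_zero.1 (hW hr s hs t ht)

/-- The bilinear pairing `β` on `Δ`. -/
def spinForm (s t : HalfSpin) : ℂ := pairing s t

/-- The moment map on `Δ`. -/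
def spinMoment (s t : HalfSpin) : so12 := ⟨moment s t, moment_mem s t⟩

/-- The simple Lie algebra `𝔢₇`, of dimension `133 = 1 + 32 + 67 + 32 + 1`, in its standard model
`𝔰𝔬₁₂ ⊕ 𝔰𝔩₂ ⊕ Δ ⊗ ℂ²`. Its underlying space is `ℂ^* ⊕ Δ^* ⊕ (𝔰𝔬₁₂ ⊕ ℂ) ⊕ Δ ⊕ ℂ`, with the summands in degrees
`-2, -1, 0, 1, 2`. The invariant symplectic form `β` is used to write elements of `Δ^*` as
elements of `Δ`. -/
def E7 : Type := ℂ × HalfSpin × (so12 × ℂ) × HalfSpin × ℂ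

namespace E7

instance : AddCommGroup E7 :=
  inferInstanceAs (AddCommGroup (ℂ × HalfSpin × (so12 × ℂ) × HalfSpin × ℂ))

instance : Module ℂ E7 :=
  inferInstanceAs (Module ℂ (ℂ × HalfSpin × (so12 × ℂ) × HalfSpin × ℂ))

/-- The component of degree `-2`. -/
def cm2 : E7 →ₗ[ℂ] ℂ := LinearMap.fst ℂ _ _

/-- The component of degree `-1`. -/
def cm1 : E7 →ₗ[ℂ] HalfSpin := LinearMap.fst ℂ _ _ ∘ₗ LinearMap.snd ℂ ℂ _

/-- The component in `𝔰𝔬₁₂`. -/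
def cso : E7 →ₗ[ℂ] so12 :=
  LinearMap.fst ℂ _ _ ∘ₗ LinearMap.fst ℂ _ _ ∘ₗ LinearMap.snd ℂ _ _ ∘ₗ LinearMap.snd ℂ ℂ _

/-- The component along the grading element. -/
def c0 : E7 →ₗ[ℂ] ℂ :=
  LinearMap.snd ℂ _ _ ∘ₗ LinearMap.fst ℂ _ _ ∘ₗ LinearMap.snd ℂ _ _ ∘ₗ LinearMap.snd ℂ ℂ _

/-- The component of degree `1`. -/
def c1 : E7 →ₗ[ℂ] HalfSpin :=
  LinearMap.fst ℂ _ _ ∘ₗ LinearMap.snd ℂ _ _ ∘ₗ LinearMap.snd ℂ _ _ ∘ₗ LinearMap.snd ℂ ℂ _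

/-- The component of degree `2`. -/
def c2 : E7 →ₗ[ℂ] ℂ :=
  LinearMap.snd ℂ _ _ ∘ₗ LinearMap.snd ℂ _ _ ∘ₗ LinearMap.snd ℂ _ _ ∘ₗ LinearMap.snd ℂ ℂ _

/-- The element with the given components. -/
def mk (p : ℂ) (u : HalfSpin) (A : so12) (h : ℂ) (v : HalfSpin) (q : ℂ) : E7 :=
  (p, u, (A, h), v, q)

section
variable (p : ℂ) (u : HalfSpin) (A : so12) (h : ℂ) (v : HalfSpin) (q : ℂ)
@[simp] theorem cm2_mk : cm2 (mk p u A h v q) = p := rfl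
@[simp] theorem cm1_mk : cm1 (mk p u A h v q) = u := rfl
@[simp] theorem cso_mk : cso (mk p u A h v q) = A := rfl
@[simp] theorem c0_mk : c0 (mk p u A h v q) = h := rfl
@[simp] theorem c1_mk : c1 (mk p u A h v q) = v := rfl
@[simp] theorem c2_mk : c2 (mk p u A h v q) = q := rfl
end

theorem ext' {x y : E7} (h1 : cm2 x = cm2 y) (h2 : cm1 x = cm1 y) (h3 : cso x = cso y)
    (h4 : c0 x = c0 y) (h5 : c1 x = c1 y) (h6 : c2 x = c2 y) : x = y :=
  Prod.ext h1 (Prod.ext h2 (Prod.ext (Prod.ext h3 h4) (Prod.ext h5 h6)))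

/-- The bracket of `𝔢₇ = 𝔰𝔬₁₂ ⊕ 𝔰𝔩₂ ⊕ Δ ⊗ ℂ²`, where `𝔰𝔩₂` is spanned by the components of
degree `-2` and `2` and the grading element, and `Δ ⊗ ℂ²` by the components of degree `±1`. -/
instance : Bracket E7 E7 where
  bracket x y := mk
    (-2 * (c0 x * cm2 y - cm2 x * c0 y) - 2 * spinForm (cm1 x) (cm1 y))
    (⁅cso x, cm1 y⁆ - ⁅cso y, cm1 x⁆ - c0 x • cm1 y + c0 y • cm1 x + cm2 x • c1 y - cm2 y • c1 x)
    (⁅cso x, cso y⁆ + spinMoment (c1 x) (cm1 y) - spinMoment (cm1 x) (c1 y))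
    (c2 x * cm2 y - cm2 x * c2 y - spinForm (c1 x) (cm1 y) - spinForm (cm1 x) (c1 y))
    (⁅cso x, c1 y⁆ - ⁅cso y, c1 x⁆ + c0 x • c1 y - c0 y • c1 x + c2 x • cm1 y - c2 y • cm1 x)
    (2 * (c0 x * c2 y - c2 x * c0 y) + 2 * spinForm (c1 x) (c1 y))

theorem lie_def (x y : E7) : ⁅x, y⁆ = mk
    (-2 * (c0 x * cm2 y - cm2 x * c0 y) - 2 * spinForm (cm1 x) (cm1 y))
    (⁅cso x, cm1 y⁆ - ⁅cso y, cm1 x⁆ - c0 x • cm1 y + c0 y • cm1 x + cm2 x • c1 y - cm2 y • c1 x)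
    (⁅cso x, cso y⁆ + spinMoment (c1 x) (cm1 y) - spinMoment (cm1 x) (c1 y))
    (c2 x * cm2 y - cm2 x * c2 y - spinForm (c1 x) (cm1 y) - spinForm (cm1 x) (c1 y))
    (⁅cso x, c1 y⁆ - ⁅cso y, c1 x⁆ + c0 x • c1 y - c0 y • c1 x + c2 x • cm1 y - c2 y • cm1 x)
    (2 * (c0 x * c2 y - c2 x * c0 y) + 2 * spinForm (c1 x) (c1 y)) := rfl

end E7

section
variable (r s t : HalfSpin) (c : ℂ) (A : so12)

theorem spinForm_add_left : spinForm (r + s) t = spinForm r t + spinForm s t := by simp [spinForm]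
theorem spinForm_add_right : spinForm r (s + t) = spinForm r s + spinForm r t := by simp [spinForm]
theorem spinForm_sub_left : spinForm (r - s) t = spinForm r t - spinForm s t := by simp [spinForm]
theorem spinForm_sub_right : spinForm r (s - t) = spinForm r s - spinForm r t := by simp [spinForm]
theorem spinForm_smul_left : spinForm (c • s) t = c * spinForm s t := by simp [spinForm]
theorem spinForm_smul_right : spinForm s (c • t) = c * spinForm s t := by simp [spinForm]
theorem spinForm_skew : spinForm s t = - spinForm t s := pairing_skew _ _
theorem spinForm_lie : spinForm ⁅A, s⁆ t = - spinForm s ⁅A, t⁆ := pairing_spin _ A.2 _ _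

theorem spinMoment_add_left : spinMoment (r + s) t = spinMoment r t + spinMoment s t := by
  ext1; simp [spinMoment]
theorem spinMoment_add_right : spinMoment r (s + t) = spinMoment r s + spinMoment r t := by
  ext1; simp [spinMoment]
theorem spinMoment_sub_left : spinMoment (r - s) t = spinMoment r t - spinMoment s t := by
  ext1; simp [spinMoment]
theorem spinMoment_sub_right : spinMoment r (s - t) = spinMoment r s - spinMoment r t := by
  ext1; simp [spinMoment]
theorem spinMoment_smul_left : spinMoment (c • s) t = c • spinMoment s t := by
  ext1; simp [spinMoment]
theorem spinMoment_smul_right : spinMoment s (c • t) = c • spinMoment s t := by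
  ext1; simp [spinMoment]
theorem spinMoment_symm : spinMoment s t = spinMoment t s := Subtype.ext (moment_symm _ _)
theorem lie_spinMoment :
    ⁅A, spinMoment s t⁆ = spinMoment ⁅A, s⁆ t + spinMoment s ⁅A, t⁆ :=
  Subtype.ext (moment_equivariant A.1 A.2 s t)
theorem spinMoment_identity : ⁅spinMoment r s, t⁆ - ⁅spinMoment r t, s⁆
    = (2 * spinForm s t) • r + spinForm r t • s - spinForm r s • t :=
  Subtype.ext (moment_identity r s t r.2 s.2 t.2)
end

namespace E7

set_option maxHeartbeats 1600000 in
instance : LieRing E7 where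
  add_lie x y z := by
    simp only [lie_def, map_add]
    apply ext' <;> simp only [map_add, cm2_mk, cm1_mk, cso_mk, c0_mk, c1_mk, c2_mk,
      spinForm_add_left, spinMoment_add_left, add_lie, lie_add, add_smul, smul_add]
    · ring
    · abel
    · abel
    · ring
    · abel
    · ring
  lie_add x y z := by
    simp only [lie_def, map_add]
    apply ext' <;> simp only [map_add, cm2_mk, cm1_mk, cso_mk, c0_mk, c1_mk, c2_mk,
      spinForm_add_right, spinMoment_add_right, add_lie, lie_add, add_smul, smul_add]
    · ring
    · abel
    · abel
    · ring
    · abel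
    · ring
  lie_self x := by
    have h : ∀ s : HalfSpin, spinForm s s = 0 := fun s => by
      have := spinForm_skew s s
      linear_combination (1 / 2 : ℂ) * this
    rw [lie_def]
    apply ext' <;> simp only [map_zero, cm2_mk, cm1_mk, cso_mk, c0_mk, c1_mk, c2_mk, h, lie_self]
    · ring
    · abel
    · rw [spinMoment_symm]; abel
    · rw [spinForm_skew]; ring
    · abel
    · ring
  leibniz_lie x y z := by
    simp only [lie_def]
    generalize cm2 x = p1, cm1 x = u1, cso x = A1, c0 x = h1, c1 x = v1, c2 x = q1,
      cm2 y = p2, cm1 y = u2, cso y = A2, c0 y = h2, c1 y = v2, c2 y = q2,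
      cm2 z = p3, cm1 z = u3, cso z = A3, c0 z = h3, c1 z = v3, c2 z = q3
    have l : ∀ (A : so12) (s t : HalfSpin), spinForm s ⁅A, t⁆ = spinForm t ⁅A, s⁆ := by
      intro A s t
      rw [spinForm_skew, spinForm_lie, neg_neg]
    have ms : ∀ (A : so12) (s t : HalfSpin), ⁅spinMoment s t, A⁆
        = -(spinMoment ⁅A, s⁆ t + spinMoment s ⁅A, t⁆) := by
      intro A s t
      rw [← lie_spinMoment, lie_skew]
    have mc : ∀ (A : so12) (s t : HalfSpin), spinMoment ⁅A, s⁆ t = spinMoment t ⁅A, s⁆ :=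
      fun A s t => spinMoment_symm _ _
    have kuv : spinForm v1 u1 = - spinForm u1 v1 ∧ spinForm v1 u2 = - spinForm u2 v1 ∧
        spinForm v1 u3 = - spinForm u3 v1 ∧ spinForm v2 u1 = - spinForm u1 v2 ∧
        spinForm v2 u2 = - spinForm u2 v2 ∧ spinForm v2 u3 = - spinForm u3 v2 ∧
        spinForm v3 u1 = - spinForm u1 v3 ∧ spinForm v3 u2 = - spinForm u2 v3 ∧
        spinForm v3 u3 = - spinForm u3 v3 :=
      ⟨spinForm_skew _ _, spinForm_skew _ _, spinForm_skew _ _, spinForm_skew _ _,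
        spinForm_skew _ _, spinForm_skew _ _, spinForm_skew _ _, spinForm_skew _ _,
        spinForm_skew _ _⟩
    have muv : spinMoment v1 u1 = spinMoment u1 v1 ∧ spinMoment v1 u2 = spinMoment u2 v1 ∧
        spinMoment v1 u3 = spinMoment u3 v1 ∧ spinMoment v2 u1 = spinMoment u1 v2 ∧
        spinMoment v2 u2 = spinMoment u2 v2 ∧ spinMoment v2 u3 = spinMoment u3 v2 ∧
        spinMoment v3 u1 = spinMoment u1 v3 ∧ spinMoment v3 u2 = spinMoment u2 v3 ∧
        spinMoment v3 u3 = spinMoment u3 v3 :=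
      ⟨spinMoment_symm _ _, spinMoment_symm _ _, spinMoment_symm _ _, spinMoment_symm _ _,
        spinMoment_symm _ _, spinMoment_symm _ _, spinMoment_symm _ _, spinMoment_symm _ _,
        spinMoment_symm _ _⟩
    apply ext' <;> simp only [map_add, cm2_mk, cm1_mk, cso_mk, c0_mk, c1_mk, c2_mk]
    · simp only [spinForm_add_left, spinForm_add_right, spinForm_sub_left, spinForm_sub_right,
        spinForm_smul_left, spinForm_smul_right, spinForm_lie, l A3 u2 u1, kuv]
      rw [spinForm_skew u2 u1]
      ring
    · have F1 := spinMoment_identity v1 u2 u3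
      have F2 := spinMoment_identity v2 u1 u3
      have F3 := spinMoment_identity v3 u1 u2
      simp only [muv, kuv, add_lie, sub_lie, lie_add, lie_sub, lie_smul, lie_lie] at F1 F2 F3 ⊢
      linear_combination (norm := module) (-1 : ℂ) • F1 + F2 - F3
    · simp only [spinMoment_add_left, spinMoment_add_right, spinMoment_sub_left,
        spinMoment_sub_right, spinMoment_smul_left, spinMoment_smul_right,
        add_lie, sub_lie, lie_add, lie_sub, lie_lie, lie_spinMoment, muv, spinMoment_symm u2 u1,
        spinMoment_symm v2 v1, ms, mc]
      module
    · simp only [spinForm_add_left, spinForm_add_right, spinForm_sub_left, spinForm_sub_right,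
        spinForm_smul_left, spinForm_smul_right, spinForm_lie, kuv]
      rw [spinForm_skew u2 u1, spinForm_skew v2 v1, l A3 v2 u1, l A3 u2 v1]
      ring
    · have F1 := spinMoment_identity u1 v2 v3
      have F2 := spinMoment_identity u2 v1 v3
      have F3 := spinMoment_identity u3 v1 v2
      simp only [muv, kuv, add_lie, sub_lie, lie_add, lie_sub, lie_smul, lie_lie] at F1 F2 F3 ⊢
      linear_combination (norm := module) F1 - F2 + F3
    · simp only [spinForm_add_left, spinForm_add_right, spinForm_sub_left, spinForm_sub_right,
        spinForm_smul_left, spinForm_smul_right, spinForm_lie, l A3 v2 v1, kuv]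
      rw [spinForm_skew v2 v1]
      ring

instance : LieAlgebra ℂ E7 where
  lie_smul c x y := by
    simp only [lie_def]
    apply ext' <;> simp only [map_smul, cm2_mk, cm1_mk, cso_mk, c0_mk, c1_mk, c2_mk,
      spinForm_smul_right, spinMoment_smul_right, smul_eq_mul, smul_lie, lie_smul]
    · ring
    · module
    · module
    · ring
    · module
    · ring

/-- The element `h` of the degree `0` part whose bracket defines the grading. -/
def gradingElement : E7 := mk 0 0 0 1 0 0

/-- The piece of degree `k` of the type `II` grading of `𝔢₇`. -/
def grade (k : ℤ) : Submodule ℂ E7 where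
  carrier := {x | ⁅gradingElement, x⁆ = (k : ℂ) • x}
  add_mem' {x y} hx hy := by
    simp only [Set.mem_ofPred_eq] at hx hy ⊢
    rw [lie_add, hx, hy, smul_add]
  zero_mem' := by simp
  smul_mem' c x hx := by
    simp only [Set.mem_ofPred_eq] at hx ⊢
    rw [lie_smul, hx, smul_comm]

/-- The inclusion of `𝔰𝔬₁₂` into the degree `0` part of `𝔢₇`. -/
def ofSo (A : so12) : E7 := mk 0 0 A 0 0 0

/-- The inclusion of `Δ` into `𝔢₇`, as the degree `1` part. -/
def ofSpin (z : HalfSpin) : E7 := mk 0 0 0 0 z 0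

theorem mem_grade_iff (k : ℤ) (x : E7) : x ∈ grade k ↔
    ((k : ℂ) + 2) * cm2 x = 0 ∧ ((k : ℂ) + 1) • cm1 x = 0 ∧ (k : ℂ) • cso x = 0 ∧
      (k : ℂ) * c0 x = 0 ∧ ((k : ℂ) - 1) • c1 x = 0 ∧ ((k : ℂ) - 2) * c2 x = 0 := by
  have z1 : ∀ s, spinForm 0 s = 0 := fun s => by simp [spinForm]
  have z2 : ∀ s, spinMoment 0 s = 0 := fun s => by ext1; simp [spinMoment]
  have key : x ∈ grade k ↔ ⁅gradingElement, x⁆ - (k : ℂ) • x = 0 := by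
    rw [sub_eq_zero]; rfl
  have e : ⁅gradingElement, x⁆ - (k : ℂ) • x = mk (-(((k : ℂ) + 2) * cm2 x))
      (-(((k : ℂ) + 1) • cm1 x)) (-((k : ℂ) • cso x)) (-((k : ℂ) * c0 x))
      (-(((k : ℂ) - 1) • c1 x)) (-(((k : ℂ) - 2) * c2 x)) := by
    rw [lie_def]
    apply ext' <;> simp only [gradingElement, map_sub, map_smul, cm2_mk, cm1_mk, cso_mk, c0_mk,
      c1_mk, c2_mk, z1, z2, zero_lie, lie_zero, smul_eq_mul]
    · ring
    · module
    · module
    · ring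
    · module
    · ring
  rw [key, e]
  constructor
  · intro h
    have g : ∀ {M : Type} [AddCommGroup M] (f : E7 → M) {a : M}, f (mk (-(((k : ℂ) + 2) * cm2 x))
      (-(((k : ℂ) + 1) • cm1 x)) (-((k : ℂ) • cso x)) (-((k : ℂ) * c0 x))
      (-(((k : ℂ) - 1) • c1 x)) (-(((k : ℂ) - 2) * c2 x))) = -a → f 0 = 0 → a = 0 := by
      intro M _ f a ha h0
      rw [h, h0] at ha
      exact neg_eq_zero.1 ha.symm
    exact ⟨g cm2 rfl (map_zero _), g cm1 rfl (map_zero _), g cso rfl (map_zero _),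
      g c0 rfl (map_zero _), g c1 rfl (map_zero _), g c2 rfl (map_zero _)⟩
  · rintro ⟨h1, h2, h3, h4, h5, h6⟩
    rw [h1, h2, h3, h4, h5, h6]
    apply ext' <;> simp

theorem lie_mem_grade {i k : ℤ} {x y : E7} (hx : x ∈ grade i) (hy : y ∈ grade k) :
    ⁅x, y⁆ ∈ grade (i + k) := by
  change ⁅gradingElement, x⁆ = (i : ℂ) • x at hx
  change ⁅gradingElement, y⁆ = (k : ℂ) • y at hy
  change ⁅gradingElement, ⁅x, y⁆⁆ = ((i + k : ℤ) : ℂ) • ⁅x, y⁆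
  rw [leibniz_lie, hx, hy, smul_lie, lie_smul]
  push_cast
  module

theorem mem_grade_one_iff (x : E7) : x ∈ grade 1 ↔ ∃ z, x = ofSpin z := by
  rw [mem_grade_iff]
  constructor
  · rintro ⟨h1, h2, h3, h4, -, h6⟩
    norm_num at h1 h2 h3 h4 h6
    exact ⟨c1 x, ext' h1 h2 h3 h4 rfl h6⟩
  · rintro ⟨z, rfl⟩
    simp [ofSpin]

theorem mem_grade_two_iff (x : E7) : x ∈ grade 2 ↔ ∃ c, x = mk 0 0 0 0 0 c := by
  rw [mem_grade_iff]
  constructor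
  · rintro ⟨h1, h2, h3, h4, h5, -⟩
    norm_num at h1 h2 h3 h4 h5
    exact ⟨c2 x, ext' h1 h2 h3 h4 h5 rfl⟩
  · rintro ⟨z, rfl⟩
    simp

theorem mem_grade_neg_two_iff (x : E7) : x ∈ grade (-2) ↔ ∃ c, x = mk c 0 0 0 0 0 := by
  rw [mem_grade_iff]
  constructor
  · rintro ⟨-, h2, h3, h4, h5, h6⟩
    norm_num at h2 h3 h4 h5 h6
    exact ⟨cm2 x, ext' rfl h2 h3 h4 h5 h6⟩
  · rintro ⟨z, rfl⟩
    simp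

theorem mem_grade_zero_iff (x : E7) : x ∈ grade 0 ↔ ∃ (A : so12) (c : ℂ), x = ofSo A + c • gradingElement := by
  rw [mem_grade_iff]
  constructor
  · rintro ⟨h1, h2, -, -, h5, h6⟩
    norm_num at h1 h2 h5 h6
    refine ⟨cso x, c0 x, ext' ?_ ?_ ?_ ?_ ?_ ?_⟩ <;> simp [ofSo, gradingElement, h1, h2, h5, h6]
  · rintro ⟨A, c, rfl⟩
    simp [ofSo, gradingElement]

theorem lie_ofSo_ofSo (A B : so12) : ⁅ofSo A, ofSo B⁆ = ofSo ⁅A, B⁆ := by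
  have z1 : ∀ s, spinForm 0 s = 0 := fun s => by simp [spinForm]
  have z2 : ∀ s, spinMoment 0 s = 0 := fun s => by ext1; simp [spinMoment]
  rw [lie_def]
  apply ext' <;> simp [ofSo, z1, z2]

theorem lie_ofSo_ofSpin (A : so12) (z : HalfSpin) : ⁅ofSo A, ofSpin z⁆ = ofSpin ⁅A, z⁆ := by
  have z1 : ∀ s, spinForm 0 s = 0 := fun s => by simp [spinForm]
  have z2 : ∀ s, spinMoment 0 s = 0 := fun s => by ext1; simp [spinMoment]
  rw [lie_def]
  apply ext' <;> simp [ofSo, ofSpin, z1, z2]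

end E7

/-- The even subsets of `{0, …, 5}`: they index the `32` coordinates on `Δ`. -/
abbrev EvenSubset : Type := {S : Finset (Fin 6) // Even S.card}

/-- The coordinate function on `Δ` attached to `S` (zero if `S` is not even). -/
def coord (S : Finset (Fin 6)) : MvPolynomial EvenSubset ℂ :=
  if h : Even S.card then MvPolynomial.X ⟨S, h⟩ else 0

/-- The value at `z ∈ Δ` of a polynomial function on `Δ`. -/
def evalAt (z : HalfSpin) : MvPolynomial EvenSubset ℂ →+* ℂ :=
  MvPolynomial.eval fun S => (z : Fock) S.1

/-- The Pfaffian of an alternating matrix of size `2n`, by expansion along the first row. -/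
def pfaffian {R : Type*} [CommRing R] : (n : ℕ) → Matrix (Fin (2 * n)) (Fin (2 * n)) R → R
  | 0, _ => 1
  | n + 1, A => ∑ j : Fin (2 * n + 1), (-1) ^ (j : ℕ) * A (0 : Fin (2 * n + 1 + 1)) j.succ *
      pfaffian n (A.submatrix (fun k => (j.succAbove k).succ) (fun k => (j.succAbove k).succ))

/-- For `i ≤ j`, the matrix obtained from `A` by crossing out the lines and columns
`i.castSucc < j.succ`. -/
def crossOut {R : Type*} (A : Matrix (Fin 6) (Fin 6) R) (i j : Fin 5) :
    Matrix (Fin 4) (Fin 4) R :=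
  A.submatrix (fun k => j.succ.succAbove (i.succAbove k))
    (fun k => j.succ.succAbove (i.succAbove k))

/-- The alternating matrix `(x_{ij})`, where `x_{ij}`, `i < j`, is the coefficient of
`e_i ∧ e_j`. -/
def igusaX : Matrix (Fin 6) (Fin 6) (MvPolynomial EvenSubset ℂ) :=
  Matrix.of fun i j => (if i < j then 1 else -1) * coord {i, j}

/-- The alternating matrix `(y_{ij})`, where `y_{ij}`, `i < j`, is the coefficient of
`(e_i ∧ e_j)^*`, the element of `⋀⁴` with `e_i ∧ e_j ∧ (e_i ∧ e_j)^* = ω` for the volume element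
`ω = e_5 ∧ e_4 ∧ e_3 ∧ e_2 ∧ e_1 ∧ e_0 = - e_0 ∧ e_1 ∧ e_2 ∧ e_3 ∧ e_4 ∧ e_5`. -/
def igusaY : Matrix (Fin 6) (Fin 6) (MvPolynomial EvenSubset ℂ) :=
  Matrix.of fun i j => (if i < j then 1 else -1) * ((-1) ^ ((i : ℕ) + (j : ℕ)) * coord {i, j}ᶜ)

/-- The Igusa quartic
`x₀ Pf(y) + y₀ Pf(x) + ∑_{i<j} Pf(X_{ij}) Pf(Y_{ij}) - ¼ (x₀ y₀ - ∑_{i<j} x_{ij} y_{ij})²`,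
where `x₀` is the coefficient of `1` and `y₀` that of the volume element `ω`. -/
def igusaQuartic : MvPolynomial EvenSubset ℂ :=
  let x₀ := coord ∅
  let y₀ := - coord Finset.univ
  x₀ * pfaffian 3 igusaY + y₀ * pfaffian 3 igusaX
    + (∑ i : Fin 5, ∑ j : Fin 5, if i ≤ j then
        pfaffian 2 (crossOut igusaX i j) * pfaffian 2 (crossOut igusaY i j) else 0)
    - MvPolynomial.C (1 / 4) *
      (x₀ * y₀ - ∑ i : Fin 6, ∑ j : Fin 6, if i < j then igusaX i j * igusaY i j else 0) ^ 2

/-- A pair of square matrices `(B, C)` is a matrix factorization of `W` if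
`B C = C B = W · I`. -/
def IsMatrixFactorization {n R : Type*} [Fintype n] [DecidableEq n] [CommRing R]
    (B C : Matrix n n R) (W : R) : Prop :=
  B * C = W • (1 : Matrix n n R) ∧ C * B = W • (1 : Matrix n n R)

/-- Let `X` generate the degree `2` part of `𝔢₇`. For `z ∈ Δ`, the operator `(ad z)²` maps
`𝔰𝔬₁₂` to `ℂ X`, so it is an element of `𝔰𝔬₁₂^*`; the matrix `M ∈ 𝔰𝔬₁₂` represents it under the
identification `𝔰𝔬₁₂^* ≃ 𝔰𝔬₁₂` given by the invariant form `(M, A) ↦ tr(M A)`. -/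
def RepresentsAdSq (X : E7) (z : HalfSpin) (M : Matrix (Fin 6 ⊕ Fin 6) (Fin 6 ⊕ Fin 6) ℂ) : Prop :=
  M ∈ so12 ∧ ∀ A : so12, ⁅E7.ofSpin z, ⁅E7.ofSpin z, E7.ofSo A⁆⁆ = (M * A).trace • X

/-- `N`, a `12 × 12` matrix of quadratic forms on `Δ`, is the matrix `((ad z)²)_{z ∈ Δ}`: its value
at each `z` is the one and only matrix in `𝔰𝔬₁₂` representing `(ad z)²`. -/
def IsAdSqMatrix (X : E7)
    (N : Matrix (Fin 6 ⊕ Fin 6) (Fin 6 ⊕ Fin 6) (MvPolynomial EvenSubset ℂ)) : Prop :=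
  (∀ p q, (N p q).IsHomogeneous 2) ∧
    ∀ (z : HalfSpin) (M : Matrix (Fin 6 ⊕ Fin 6) (Fin 6 ⊕ Fin 6) ℂ),
      RepresentsAdSq X z M ↔ M = N.map (evalAt z)

end SpinE7

end

noncomputable section

namespace SpinE7

section Pfaffian
variable {R : Type*} [CommRing R]

theorem pfaffian_two (A : Matrix (Fin 4) (Fin 4) R) :
    pfaffian 2 A = A 0 1 * A 2 3 - A 0 2 * A 1 3 + A 0 3 * A 1 2 := by
  simp [pfaffian, Fin.sum_univ_succ, Fin.succAbove]
  ring

/-- The Pfaffian of the principal `4 × 4` submatrix of `A` on the rows `a, b, c, d`. -/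
def subPfaffian {n : Type*} (A : Matrix n n R) (a b c d : n) : R :=
  A a b * A c d - A a c * A b d + A a d * A b c

theorem pfaffian_three (A : Matrix (Fin 6) (Fin 6) R) :
    pfaffian 3 A = A 0 1 * subPfaffian A 2 3 4 5 - A 0 2 * subPfaffian A 1 3 4 5
      + A 0 3 * subPfaffian A 1 2 4 5 - A 0 4 * subPfaffian A 1 2 3 5
      + A 0 5 * subPfaffian A 1 2 3 4 := by
  have h : pfaffian 3 A = ∑ j : Fin 5, (-1) ^ (j : ℕ) * A 0 j.succ *
      pfaffian 2 (A.submatrix (fun k => (j.succAbove k).succ) (fun k => (j.succAbove k).succ)) :=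
    rfl
  rw [h]
  simp [pfaffian_two, Fin.sum_univ_succ, Fin.succAbove, subPfaffian]
  ring

/-- The Pfaffian adjoint of an alternating `6 × 6` matrix: for `i < j` its entry is `(-1)^{i+j}`
times the Pfaffian of the matrix with the `i`-th and `j`-th lines and columns crossed out. -/
def pfaffianAdjoint (A : Matrix (Fin 6) (Fin 6) R) : Matrix (Fin 6) (Fin 6) R :=
  let P := subPfaffian A
  !![0, -P 2 3 4 5, P 1 3 4 5, -P 1 2 4 5, P 1 2 3 5, -P 1 2 3 4;
    P 2 3 4 5, 0, -P 0 3 4 5, P 0 2 4 5, -P 0 2 3 5, P 0 2 3 4;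
    -P 1 3 4 5, P 0 3 4 5, 0, -P 0 1 4 5, P 0 1 3 5, -P 0 1 3 4;
    P 1 2 4 5, -P 0 2 4 5, P 0 1 4 5, 0, -P 0 1 2 5, P 0 1 2 4;
    -P 1 2 3 5, P 0 2 3 5, -P 0 1 3 5, P 0 1 2 5, 0, -P 0 1 2 3;
    P 1 2 3 4, -P 0 2 3 4, P 0 1 3 4, -P 0 1 2 4, P 0 1 2 3, 0]

/-- Half the trace form `∑_{i<j} x_{ij} y_{ij}` of two alternating matrices. -/
def alternatingPairing (x y : Matrix (Fin 6) (Fin 6) R) : R :=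
  ∑ i : Fin 6, ∑ j : Fin 6, if i < j then x i j * y i j else 0

/-- The sum of the products of complementary `4 × 4` sub-Pfaffians of two matrices. -/
def crossOutPairing (x y : Matrix (Fin 6) (Fin 6) R) : R :=
  ∑ i : Fin 5, ∑ j : Fin 5, if i ≤ j then
    pfaffian 2 (crossOut x i j) * pfaffian 2 (crossOut y i j) else 0

theorem alternatingPairing_eq (x y : Matrix (Fin 6) (Fin 6) R) :
    alternatingPairing x y = x 0 1 * y 0 1 + x 0 2 * y 0 2 + x 0 3 * y 0 3 + x 0 4 * y 0 4
      + x 0 5 * y 0 5 + x 1 2 * y 1 2 + x 1 3 * y 1 3 + x 1 4 * y 1 4 + x 1 5 * y 1 5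
      + x 2 3 * y 2 3 + x 2 4 * y 2 4 + x 2 5 * y 2 5 + x 3 4 * y 3 4 + x 3 5 * y 3 5
      + x 4 5 * y 4 5 := by
  simp [alternatingPairing, Fin.sum_univ_six]
  ring

set_option maxHeartbeats 1000000 in
theorem crossOutPairing_eq (x y : Matrix (Fin 6) (Fin 6) R) :
    crossOutPairing x y = subPfaffian x 2 3 4 5 * subPfaffian y 2 3 4 5
      + subPfaffian x 1 3 4 5 * subPfaffian y 1 3 4 5 + subPfaffian x 1 2 4 5 * subPfaffian y 1 2 4 5
      + subPfaffian x 1 2 3 5 * subPfaffian y 1 2 3 5 + subPfaffian x 1 2 3 4 * subPfaffian y 1 2 3 4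
      + subPfaffian x 0 3 4 5 * subPfaffian y 0 3 4 5 + subPfaffian x 0 2 4 5 * subPfaffian y 0 2 4 5
      + subPfaffian x 0 2 3 5 * subPfaffian y 0 2 3 5 + subPfaffian x 0 2 3 4 * subPfaffian y 0 2 3 4
      + subPfaffian x 0 1 4 5 * subPfaffian y 0 1 4 5 + subPfaffian x 0 1 3 5 * subPfaffian y 0 1 3 5
      + subPfaffian x 0 1 3 4 * subPfaffian y 0 1 3 4 + subPfaffian x 0 1 2 5 * subPfaffian y 0 1 2 5
      + subPfaffian x 0 1 2 4 * subPfaffian y 0 1 2 4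
      + subPfaffian x 0 1 2 3 * subPfaffian y 0 1 2 3 := by
  have h : ∀ (A : Matrix (Fin 6) (Fin 6) R) (i j : Fin 5), pfaffian 2 (crossOut A i j)
      = subPfaffian A (j.succ.succAbove (i.succAbove 0)) (j.succ.succAbove (i.succAbove 1))
        (j.succ.succAbove (i.succAbove 2)) (j.succ.succAbove (i.succAbove 3)) :=
    fun A i j => pfaffian_two _
  simp only [crossOutPairing, h, Fin.sum_univ_five]
  simp [Fin.succAbove]
  ring

variable (x y : Matrix (Fin 6) (Fin 6) R)

theorem lower_entries_of_skew {A : Matrix (Fin 6) (Fin 6) R} (h : ∀ i j, A j i = -A i j) :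
    A 1 0 = -A 0 1 ∧ A 2 0 = -A 0 2 ∧ A 3 0 = -A 0 3 ∧ A 4 0 = -A 0 4 ∧ A 5 0 = -A 0 5 ∧
    A 2 1 = -A 1 2 ∧ A 3 1 = -A 1 3 ∧ A 4 1 = -A 1 4 ∧ A 5 1 = -A 1 5 ∧ A 3 2 = -A 2 3 ∧
    A 4 2 = -A 2 4 ∧ A 5 2 = -A 2 5 ∧ A 4 3 = -A 3 4 ∧ A 5 3 = -A 3 5 ∧ A 5 4 = -A 4 5 := by
  refine ⟨?_, ?_, ?_, ?_, ?_, ?_, ?_, ?_, ?_, ?_, ?_, ?_, ?_, ?_, ?_⟩ <;> exact h _ _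

theorem mul_pfaffianAdjoint (e : ∀ i j, x j i = -x i j) (hx : ∀ i, x i i = 0) :
    x * pfaffianAdjoint x = pfaffian 3 x • (1 : Matrix (Fin 6) (Fin 6) R) := by
  have l := lower_entries_of_skew e
  rw [pfaffian_three]
  ext i j
  fin_cases i <;> fin_cases j <;>
    simp [Matrix.mul_apply, pfaffianAdjoint, Fin.sum_univ_six, hx, l, subPfaffian] <;> ring
theorem pfaffianAdjoint_skew (i j : Fin 6) : pfaffianAdjoint x j i = -pfaffianAdjoint x i j := by
  fin_cases i <;> fin_cases j <;> simp [pfaffianAdjoint]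

theorem transpose_eq_neg {n : Type*} {A : Matrix n n R} (h : ∀ i j, A j i = -A i j) :
    A.transpose = -A :=
  Matrix.ext h

theorem pfaffianAdjoint_mul (e : ∀ i j, x j i = -x i j) (hx0 : ∀ i, x i i = 0) :
    pfaffianAdjoint x * x = pfaffian 3 x • (1 : Matrix (Fin 6) (Fin 6) R) := by
  have h := congrArg Matrix.transpose (mul_pfaffianAdjoint x e hx0)
  rwa [Matrix.transpose_mul, transpose_eq_neg e, transpose_eq_neg (pfaffianAdjoint_skew x),
    neg_mul_neg, Matrix.transpose_smul, Matrix.transpose_one] at h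

set_option maxHeartbeats 4000000 in
/-- The quadratic relation satisfied by the product of two alternating `6 × 6` matrices. -/
theorem mul_mul_add_pfaffianAdjoint_mul (ex : ∀ i j, x j i = -x i j) (hx : ∀ i, x i i = 0)
    (ey : ∀ i j, y j i = -y i j) (hy : ∀ i, y i i = 0) :
    x * y * (x * y) + alternatingPairing x y • (x * y) + pfaffianAdjoint y * pfaffianAdjoint x
      = -crossOutPairing x y • (1 : Matrix (Fin 6) (Fin 6) R) := by
  have lx := lower_entries_of_skew ex
  have ly := lower_entries_of_skew ey
  rw [alternatingPairing_eq, crossOutPairing_eq]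
  ext i j
  rw [Matrix.add_apply, Matrix.add_apply, Matrix.smul_apply, Matrix.smul_apply, Matrix.mul_apply,
    Matrix.mul_apply (M := pfaffianAdjoint y), Matrix.one_apply]
  simp only [Matrix.mul_apply, Fin.sum_univ_six, pfaffianAdjoint, subPfaffian, smul_eq_mul]
  fin_cases i <;> fin_cases j <;>
    simp only [hx, hy, lx, ly, Fin.reduceFinMk, Fin.mk_one, Fin.zero_eta, Matrix.of_apply,
      Matrix.cons_val, Fin.isValue, Fin.reduceEq, if_true, if_false] <;> ring
end Pfaffian

section Blocks
variable {R : Type*} [CommRing R]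

/-- The `12 × 12` matrix of quadratic forms in `(x₀, x, y, y₀)`, where `s` stands for half of
`∑_{i<j} x_{ij} y_{ij} - x₀ y₀`. -/
def quadraticMatrix (x₀ : R) (x y : Matrix (Fin 6) (Fin 6) R) (y₀ s : R) :
    Matrix (Fin 6 ⊕ Fin 6) (Fin 6 ⊕ Fin 6) R :=
  Matrix.fromBlocks (x * y + s • 1) (y₀ • x - pfaffianAdjoint y)
    (x₀ • y - pfaffianAdjoint x) (-(y * x + s • 1))

theorem quadraticMatrix_mul_self (x₀ : R) (x y : Matrix (Fin 6) (Fin 6) R) (y₀ s : R)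
    (ex : ∀ i j, x j i = -x i j) (hx : ∀ i, x i i = 0)
    (ey : ∀ i j, y j i = -y i j) (hy : ∀ i, y i i = 0)
    (hs : 2 * s = alternatingPairing x y - x₀ * y₀) :
    quadraticMatrix x₀ x y y₀ s * quadraticMatrix x₀ x y y₀ s
      = -(x₀ * pfaffian 3 y + y₀ * pfaffian 3 x + crossOutPairing x y - s ^ 2) •
        (1 : Matrix (Fin 6 ⊕ Fin 6) (Fin 6 ⊕ Fin 6) R) := by
  have a1 := mul_pfaffianAdjoint x ex hx
  have a2 := pfaffianAdjoint_mul x ex hx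
  have b1 := mul_pfaffianAdjoint y ey hy
  have b2 := pfaffianAdjoint_mul y ey hy
  have h1 := mul_mul_add_pfaffianAdjoint_mul x y ex hx ey hy
  have h2 := congrArg Matrix.transpose h1
  simp only [Matrix.transpose_add, Matrix.transpose_mul, Matrix.transpose_smul,
    Matrix.transpose_one, transpose_eq_neg ex, transpose_eq_neg ey,
    transpose_eq_neg (pfaffianAdjoint_skew x), transpose_eq_neg (pfaffianAdjoint_skew y),
    neg_mul_neg] at h2
  have hτ : alternatingPairing x y = 2 * s + x₀ * y₀ := by rw [hs]; ring
  rw [hτ] at h1 h2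
  rw [quadraticMatrix, Matrix.fromBlocks_multiply, ← Matrix.fromBlocks_one,
    Matrix.fromBlocks_smul]
  generalize pfaffianAdjoint x = x' at *
  generalize pfaffianAdjoint y = y' at *
  generalize pfaffian 3 x = p at *
  generalize pfaffian 3 y = q at *
  congr 1
  · have e : (x * y + s • 1) * (x * y + s • 1) + (y₀ • x - y') * (x₀ • y - x')
        = (x * y * (x * y) + (2 * s + x₀ * y₀) • (x * y) + y' * x') - y₀ • (x * x')
          - x₀ • (y' * y) + s ^ 2 • (1 : Matrix (Fin 6) (Fin 6) R) := by
      simp only [add_mul, mul_add, sub_mul, mul_sub, smul_mul_assoc, mul_smul_comm, mul_one,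
        one_mul]
      module
    rw [e, h1, a1, b2]
    module
  · have e : (x * y + s • 1) * (y₀ • x - y') + (y₀ • x - y') * -(y * x + s • 1)
        = (y' * y) * x - x * (y * y') := by
      simp only [add_mul, mul_add, sub_mul, mul_sub, smul_mul_assoc, mul_smul_comm, mul_one,
        one_mul, mul_neg, ← mul_assoc]
      module
    rw [e, b1, b2]
    simp
  · have e : (x₀ • y - x') * (x * y + s • 1) + -(y * x + s • 1) * (x₀ • y - x')
        = y * (x * x') - (x' * x) * y := by
      simp only [add_mul, mul_add, sub_mul, mul_sub, smul_mul_assoc, mul_smul_comm, mul_one,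
        one_mul, neg_mul, ← mul_assoc]
      module
    rw [e, a1, a2]
    simp
  · have e : (x₀ • y - x') * (y₀ • x - y') + -(y * x + s • 1) * -(y * x + s • 1)
        = (y * x * (y * x) + (2 * s + x₀ * y₀) • (y * x) + x' * y') - y₀ • (x' * x)
          - x₀ • (y * y') + s ^ 2 • (1 : Matrix (Fin 6) (Fin 6) R) := by
      simp only [add_mul, mul_add, sub_mul, mul_sub, smul_mul_assoc, mul_smul_comm, mul_one,
        one_mul, neg_mul_neg]
      module
    rw [e, h2, a2, b1]
    module

end Blocks

/-- The subset of `{0, …, 5}` with the given characteristic function. -/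
def ofBits (a b c d e g : Bool) : Finset (Fin 6) :=
  Finset.univ.filter fun i => ![a, b, c, d, e, g] i

/-- The sign `-1` attached to a factor that is present. -/
def bitSign (b : Bool) : ℂ := bif b then -1 else 1

@[simp] theorem bitSign_true : bitSign true = -1 := rfl

@[simp] theorem bitSign_false : bitSign false = 1 := rfl

theorem bitSign_eq_pow (b : Bool) : bitSign b = (-1) ^ b.toNat := by cases b <;> simp

theorem mem_ofBits (i : Fin 6) (a b c d e g : Bool) :
    i ∈ ofBits a b c d e g ↔ ![a, b, c, d, e, g] i = true := by
  simp [ofBits]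

theorem card_filter_ofBits : ∀ a b c d e g : Bool, ∀ i : Fin 6,
    ((ofBits a b c d e g).filter (· < i)).card =
      (a && decide (0 < i)).toNat + (b && decide (1 < i)).toNat + (c && decide (2 < i)).toNat
        + (d && decide (3 < i)).toNat + (e && decide (4 < i)).toNat := by
  decide +kernel

theorem moveSign_ofBits (i : Fin 6) (a b c d e g : Bool) :
    moveSign i (ofBits a b c d e g) =
      bitSign (a && decide (0 < i)) * bitSign (b && decide (1 < i)) * bitSign (c && decide (2 < i))
        * bitSign (d && decide (3 < i)) * bitSign (e && decide (4 < i)) := by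
  simp only [moveSign, card_filter_ofBits, bitSign_eq_pow, pow_add]

theorem erase_ofBits : ∀ a b c d e g : Bool, ∀ i : Fin 6, (ofBits a b c d e g).erase i =
    ofBits (a && decide (i ≠ 0)) (b && decide (i ≠ 1)) (c && decide (i ≠ 2)) (d && decide (i ≠ 3))
      (e && decide (i ≠ 4)) (g && decide (i ≠ 5)) := by
  decide +kernel

theorem insert_ofBits : ∀ a b c d e g : Bool, ∀ i : Fin 6, insert i (ofBits a b c d e g) =
    ofBits (a || decide (i = 0)) (b || decide (i = 1)) (c || decide (i = 2)) (d || decide (i = 3))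
      (e || decide (i = 4)) (g || decide (i = 5)) := by
  decide +kernel

theorem compl_ofBits : ∀ a b c d e g : Bool,
    (ofBits a b c d e g)ᶜ = ofBits (!a) (!b) (!c) (!d) (!e) (!g) := by
  decide +kernel

section
variable (f : Fock) (a b c d e g : Bool)

theorem wedge_zero_ofBits : wedge 0 f (ofBits a b c d e g)
    = bif a then f (ofBits false b c d e g) else 0 := by
  cases a <;> simp [wedge_apply, mem_ofBits, moveSign_ofBits, erase_ofBits]

theorem wedge_one_ofBits : wedge 1 f (ofBits a b c d e g)
    = bif b then bitSign a * f (ofBits a false c d e g) else 0 := by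
  cases b <;> simp [wedge_apply, mem_ofBits, moveSign_ofBits, erase_ofBits]

theorem wedge_two_ofBits : wedge 2 f (ofBits a b c d e g)
    = bif c then bitSign a * bitSign b * f (ofBits a b false d e g) else 0 := by
  cases c <;> simp [wedge_apply, mem_ofBits, moveSign_ofBits, erase_ofBits]

theorem wedge_three_ofBits : wedge 3 f (ofBits a b c d e g)
    = bif d then bitSign a * bitSign b * bitSign c * f (ofBits a b c false e g) else 0 := by
  cases d <;> simp [wedge_apply, mem_ofBits, moveSign_ofBits, erase_ofBits]

theorem wedge_four_ofBits : wedge 4 f (ofBits a b c d e g)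
    = bif e then bitSign a * bitSign b * bitSign c * bitSign d * f (ofBits a b c d false g)
      else 0 := by
  cases e <;> simp [wedge_apply, mem_ofBits, moveSign_ofBits, erase_ofBits]

theorem wedge_five_ofBits : wedge 5 f (ofBits a b c d e g)
    = bif g then bitSign a * bitSign b * bitSign c * bitSign d * bitSign e * f (ofBits a b c d e false)
      else 0 := by
  cases g <;> simp [wedge_apply, mem_ofBits, moveSign_ofBits, erase_ofBits]

theorem contract_zero_ofBits : contract 0 f (ofBits a b c d e g)
    = bif a then 0 else f (ofBits true b c d e g) := by
  cases a <;> simp [contract_apply, mem_ofBits, moveSign_ofBits, insert_ofBits]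

theorem contract_one_ofBits : contract 1 f (ofBits a b c d e g)
    = bif b then 0 else bitSign a * f (ofBits a true c d e g) := by
  cases b <;> simp [contract_apply, mem_ofBits, moveSign_ofBits, insert_ofBits]

theorem contract_two_ofBits : contract 2 f (ofBits a b c d e g)
    = bif c then 0 else bitSign a * bitSign b * f (ofBits a b true d e g) := by
  cases c <;> simp [contract_apply, mem_ofBits, moveSign_ofBits, insert_ofBits]

theorem contract_three_ofBits : contract 3 f (ofBits a b c d e g)
    = bif d then 0 else bitSign a * bitSign b * bitSign c * f (ofBits a b c true e g) := by
  cases d <;> simp [contract_apply, mem_ofBits, moveSign_ofBits, insert_ofBits]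

theorem contract_four_ofBits : contract 4 f (ofBits a b c d e g)
    = bif e then 0
      else bitSign a * bitSign b * bitSign c * bitSign d * f (ofBits a b c d true g) := by
  cases e <;> simp [contract_apply, mem_ofBits, moveSign_ofBits, insert_ofBits]

theorem contract_five_ofBits : contract 5 f (ofBits a b c d e g)
    = bif g then 0
      else bitSign a * bitSign b * bitSign c * bitSign d * bitSign e * f (ofBits a b c d e true) := by
  cases g <;> simp [contract_apply, mem_ofBits, moveSign_ofBits, insert_ofBits]

end

theorem sum_bits_ofBits (F : Finset (Fin 6) → ℂ) :
    ∑ S, F S = ∑ a, ∑ b, ∑ c, ∑ d, ∑ e, ∑ g, F (ofBits a b c d e g) := by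
  let φ : Bool × Bool × Bool × Bool × Bool × Bool → Finset (Fin 6) :=
    fun v => ofBits v.1 v.2.1 v.2.2.1 v.2.2.2.1 v.2.2.2.2.1 v.2.2.2.2.2
  have hφ : Function.Bijective φ := by
    rw [Fintype.bijective_iff_surjective_and_card]
    refine ⟨fun S => ⟨(decide (0 ∈ S), decide (1 ∈ S), decide (2 ∈ S), decide (3 ∈ S),
      decide (4 ∈ S), decide (5 ∈ S)), ?_⟩, by simp⟩
    ext i
    fin_cases i <;> simp [φ, mem_ofBits]
  rw [← Function.Bijective.sum_comp hφ]
  simp only [Fintype.sum_prod_type, φ]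

theorem sum_coe_ofBits : ∀ a b c d e g : Bool, ∑ i ∈ ofBits a b c d e g, (i : ℕ) =
    b.toNat + 2 * (c.toNat + d.toNat + 2 * e.toNat + 2 * g.toNat) + d.toNat + g.toNat := by
  decide +kernel

theorem even_card_ofBits : ∀ a b c d e : Bool,
    Even (ofBits a b c d e (a ^^ b ^^ c ^^ d ^^ e)).card := by
  decide +kernel

theorem pairing_eq_sum_odd {s : Fock} (t : Fock)
    (hs : ∀ S : Finset (Fin 6), Even S.card → s S = 0) : pairing s t =
    ∑ a, ∑ b, ∑ c, ∑ d, ∑ e, bitSign (b ^^ d ^^ !(a ^^ b ^^ c ^^ d ^^ e)) *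
      s (ofBits a b c d e !(a ^^ b ^^ c ^^ d ^^ e)) *
        t (ofBits (!a) (!b) (!c) (!d) (!e) (a ^^ b ^^ c ^^ d ^^ e)) := by
  rw [pairing_apply, sum_bits_ofBits]
  refine Finset.sum_congr rfl fun a _ => Finset.sum_congr rfl fun b _ =>
    Finset.sum_congr rfl fun c _ => Finset.sum_congr rfl fun d _ =>
    Finset.sum_congr rfl fun e _ => ?_
  rw [Finset.sum_eq_single !(a ^^ b ^^ c ^^ d ^^ e), compl_ofBits, Bool.not_not, sum_coe_ofBits]
  · congr 2
    generalize (!(a ^^ b ^^ c ^^ d ^^ e)) = g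
    rw [pow_add, pow_add, pow_add, pow_mul, neg_one_sq, one_pow, mul_one, ← bitSign_eq_pow,
      ← bitSign_eq_pow, ← bitSign_eq_pow]
    cases b <;> cases d <;> cases g <;> simp
  · intro g _ hg
    have h := even_card_ofBits a b c d e
    rw [← Bool.not_not (a ^^ b ^^ c ^^ d ^^ e), ← Bool.eq_not.2 hg] at h
    rw [hs _ h]
    simp
  · simp

theorem moment_self_apply (z : Fock) (p q : Fin 6 ⊕ Fin 6) :
    moment z z p q = 2 * pairing (gamma q z) (gamma p.swap z) := by
  rw [moment_apply, LinearMap.sub_apply, Module.End.mul_apply, Module.End.mul_apply, map_sub,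
    LinearMap.sub_apply, pairing_gamma p.swap, pairing_gamma q (gamma p.swap z),
    pairing_skew (gamma p.swap z)]
  ring

theorem gamma_even_eq_zero {z : Fock} (hz : z ∈ HalfSpin) (p : Fin 6 ⊕ Fin 6)
    (S : Finset (Fin 6)) (hS : Even S.card) : gamma p z S = 0 :=
  gamma_parity p z False (fun T hT => hz T (by simpa using hT)) S (by simpa using hS)

theorem moment_self_eq_sum {z : Fock} (hz : z ∈ HalfSpin) (p q : Fin 6 ⊕ Fin 6) :
    moment z z p q = 2 * ∑ a, ∑ b, ∑ c, ∑ d, ∑ e,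
      bitSign (b ^^ d ^^ !(a ^^ b ^^ c ^^ d ^^ e)) *
      gamma q z (ofBits a b c d e !(a ^^ b ^^ c ^^ d ^^ e)) *
        gamma p.swap z (ofBits (!a) (!b) (!c) (!d) (!e) (a ^^ b ^^ c ^^ d ^^ e)) := by
  rw [moment_self_apply, pairing_eq_sum_odd _ (gamma_even_eq_zero hz _)]

/-- The alternating matrix of the coordinates of a spinor on `⋀² ℂ⁶`. -/
def spinorX (z : Fock) : Matrix (Fin 6) (Fin 6) ℂ :=
  Matrix.of fun i j => (if i < j then 1 else -1) * z {i, j}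

/-- The alternating matrix of the coordinates of a spinor on `⋀⁴ ℂ⁶`. -/
def spinorY (z : Fock) : Matrix (Fin 6) (Fin 6) ℂ :=
  Matrix.of fun i j => (if i < j then 1 else -1) * ((-1) ^ ((i : ℕ) + (j : ℕ)) * z {i, j}ᶜ)

theorem spinorX_entries (z : Fock) :
    spinorX z 0 1 = z (ofBits true true false false false false) ∧
    spinorX z 0 2 = z (ofBits true false true false false false) ∧
    spinorX z 0 3 = z (ofBits true false false true false false) ∧
    spinorX z 0 4 = z (ofBits true false false false true false) ∧
    spinorX z 0 5 = z (ofBits true false false false false true) ∧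
    spinorX z 1 2 = z (ofBits false true true false false false) ∧
    spinorX z 1 3 = z (ofBits false true false true false false) ∧
    spinorX z 1 4 = z (ofBits false true false false true false) ∧
    spinorX z 1 5 = z (ofBits false true false false false true) ∧
    spinorX z 2 3 = z (ofBits false false true true false false) ∧
    spinorX z 2 4 = z (ofBits false false true false true false) ∧
    spinorX z 2 5 = z (ofBits false false true false false true) ∧
    spinorX z 3 4 = z (ofBits false false false true true false) ∧
    spinorX z 3 5 = z (ofBits false false false true false true) ∧
    spinorX z 4 5 = z (ofBits false false false false true true) := by
  refine ⟨?_, ?_, ?_, ?_, ?_, ?_, ?_, ?_, ?_, ?_, ?_, ?_, ?_, ?_, ?_⟩ <;>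
    simp only [spinorX, Matrix.of_apply] <;>
    rw [if_pos (by decide), one_mul] <;>
    exact congrArg z (by decide)

theorem spinorY_entries (z : Fock) :
    spinorY z 0 1 = -z (ofBits false false true true true true) ∧
    spinorY z 0 2 = z (ofBits false true false true true true) ∧
    spinorY z 0 3 = -z (ofBits false true true false true true) ∧
    spinorY z 0 4 = z (ofBits false true true true false true) ∧
    spinorY z 0 5 = -z (ofBits false true true true true false) ∧
    spinorY z 1 2 = -z (ofBits true false false true true true) ∧
    spinorY z 1 3 = z (ofBits true false true false true true) ∧
    spinorY z 1 4 = -z (ofBits true false true true false true) ∧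
    spinorY z 1 5 = z (ofBits true false true true true false) ∧
    spinorY z 2 3 = -z (ofBits true true false false true true) ∧
    spinorY z 2 4 = z (ofBits true true false true false true) ∧
    spinorY z 2 5 = -z (ofBits true true false true true false) ∧
    spinorY z 3 4 = -z (ofBits true true true false false true) ∧
    spinorY z 3 5 = z (ofBits true true true false true false) ∧
    spinorY z 4 5 = -z (ofBits true true true true false false) := by
  refine ⟨?_, ?_, ?_, ?_, ?_, ?_, ?_, ?_, ?_, ?_, ?_, ?_, ?_, ?_, ?_⟩ <;>
    simp only [spinorY, Matrix.of_apply] <;>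
    rw [if_pos (by decide), one_mul] <;>
    norm_num <;>
    exact congrArg z (by decide)

theorem spinorX_skew (z : Fock) (i j : Fin 6) (hz : z ∈ HalfSpin) :
    spinorX z j i = -spinorX z i j := by
  rcases lt_trichotomy i j with h | rfl | h
  · simp [spinorX, h, h.not_gt, Finset.pair_comm j i]
  · simp [spinorX, hz {i} (by simp)]
  · simp [spinorX, h, h.not_gt, Finset.pair_comm j i]

theorem spinorY_skew (z : Fock) (i j : Fin 6) (hz : z ∈ HalfSpin) :
    spinorY z j i = -spinorY z i j := by
  have h1 : ∀ i : Fin 6, ¬ Even (({i} : Finset (Fin 6))ᶜ).card := by decide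
  rcases lt_trichotomy i j with h | rfl | h
  · simp only [spinorY, Matrix.of_apply, h, h.not_gt, Finset.pair_comm j i, add_comm (j : ℕ) i,
      if_true, if_false]
    ring
  · simp [spinorY, hz _ (h1 i)]
  · simp only [spinorY, Matrix.of_apply, h, h.not_gt, Finset.pair_comm j i, add_comm (j : ℕ) i,
      if_true, if_false]
    ring

theorem self_eq_zero_of_skew {A : Matrix (Fin 6) (Fin 6) ℂ} (h : ∀ i j, A j i = -A i j)
    (i : Fin 6) : A i i = 0 := by
  linear_combination (1 / 2 : ℂ) * h i i

set_option maxHeartbeats 4000000 in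
theorem moment_self_inl_inr {z : Fock} (hz : z ∈ HalfSpin) (i j : Fin 6) :
    moment z z (.inl i) (.inr j)
      = 4 * (-z Finset.univ * spinorX z i j - pfaffianAdjoint (spinorY z) i j) := by
  have sX : ∀ i j, spinorX z j i = -spinorX z i j := fun i j => spinorX_skew z i j hz
  have dX := self_eq_zero_of_skew sX
  have lX := lower_entries_of_skew sX
  have uX := spinorX_entries z
  have uY := spinorY_entries z
  rw [moment_self_eq_sum hz, show (z Finset.univ : ℂ) = z (ofBits true true true true true true) from
    congrArg z (by decide)]
  clear sX
  generalize spinorX z = X at *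
  generalize spinorY z = Y at *
  simp only [pfaffianAdjoint, subPfaffian, gamma]
  fin_cases i <;> fin_cases j <;>
        simp only [Sum.swap_inl, Sum.elim_inr, Fintype.sum_bool, cond_true, cond_false,
      bitSign_true, bitSign_false, Bool.not_true, Bool.not_false, Bool.xor_true, Bool.xor_false,
      Bool.true_xor, Bool.false_xor, mul_zero, zero_mul, add_zero, zero_add, Fin.reduceFinMk,
      Fin.mk_one, Fin.zero_eta, Fin.isValue, Matrix.of_apply, Matrix.cons_val,
      contract_zero_ofBits, contract_one_ofBits, contract_two_ofBits, contract_three_ofBits,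
      contract_four_ofBits, contract_five_ofBits, uX, lX, dX, uY] <;> ring

set_option maxHeartbeats 4000000 in
theorem moment_self_inr_inl {z : Fock} (hz : z ∈ HalfSpin) (i j : Fin 6) :
    moment z z (.inr i) (.inl j) = 4 * (z ∅ * spinorY z i j - pfaffianAdjoint (spinorX z) i j) := by
  have sY : ∀ i j, spinorY z j i = -spinorY z i j := fun i j => spinorY_skew z i j hz
  have dY := self_eq_zero_of_skew sY
  have lY := lower_entries_of_skew sY
  have uX := spinorX_entries z
  have uY := spinorY_entries z
  rw [moment_self_eq_sum hz, show (z ∅ : ℂ) = z (ofBits false false false false false false) from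
    congrArg z (by decide)]
  clear sY
  generalize spinorX z = X at *
  generalize spinorY z = Y at *
  simp only [pfaffianAdjoint, subPfaffian, gamma]
  fin_cases i <;> fin_cases j <;>
        simp only [Sum.swap_inr, Sum.elim_inl, Fintype.sum_bool, cond_true, cond_false,
      bitSign_true, bitSign_false, Bool.not_true, Bool.not_false, Bool.xor_true, Bool.xor_false,
      Bool.true_xor, Bool.false_xor, mul_zero, zero_mul, add_zero, zero_add, Fin.reduceFinMk,
      Fin.mk_one, Fin.zero_eta, Fin.isValue, Matrix.of_apply, Matrix.cons_val, wedge_zero_ofBits,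
      wedge_one_ofBits, wedge_two_ofBits, wedge_three_ofBits, wedge_four_ofBits,
      wedge_five_ofBits, uX, uY, lY, dY] <;> ring

set_option maxHeartbeats 4000000 in
theorem moment_self_inl_inl {z : Fock} (hz : z ∈ HalfSpin) (i j : Fin 6) :
    moment z z (.inl i) (.inl j) = 4 * (spinorX z * spinorY z) i j
      + if i = j then 2 * (alternatingPairing (spinorX z) (spinorY z) + z ∅ * z Finset.univ)
        else 0 := by
  have sX : ∀ i j, spinorX z j i = -spinorX z i j := fun i j => spinorX_skew z i j hz
  have sY : ∀ i j, spinorY z j i = -spinorY z i j := fun i j => spinorY_skew z i j hz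
  have dX := self_eq_zero_of_skew sX
  have dY := self_eq_zero_of_skew sY
  have lX := lower_entries_of_skew sX
  have lY := lower_entries_of_skew sY
  have uX := spinorX_entries z
  have uY := spinorY_entries z
  rw [moment_self_eq_sum hz, alternatingPairing_eq,
    show (z ∅ : ℂ) = z (ofBits false false false false false false) from congrArg z (by decide),
    show (z Finset.univ : ℂ) = z (ofBits true true true true true true) from
      congrArg z (by decide)]
  clear sX sY
  generalize spinorX z = X at *
  generalize spinorY z = Y at *
  fin_cases i <;> fin_cases j <;>
        simp only [gamma, Sum.swap_inl, Sum.elim_inl, Sum.elim_inr, Fintype.sum_bool, cond_true,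
      cond_false, bitSign_true, bitSign_false, Bool.not_true, Bool.not_false, Bool.xor_true,
      Bool.xor_false, Bool.true_xor, Bool.false_xor, mul_zero, zero_mul, add_zero, zero_add,
      Fin.reduceFinMk, Fin.mk_one, Fin.zero_eta, Fin.isValue, Fin.reduceEq, if_true, if_false,
      wedge_zero_ofBits, wedge_one_ofBits, wedge_two_ofBits, wedge_three_ofBits,
      wedge_four_ofBits, wedge_five_ofBits, contract_zero_ofBits, contract_one_ofBits,
      contract_two_ofBits, contract_three_ofBits, contract_four_ofBits, contract_five_ofBits, uX,
      lX, dX, uY, lY, dY, Matrix.mul_apply, Fin.sum_univ_six] <;> ring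

theorem map_pfaffianAdjoint {R S : Type*} [CommRing R] [CommRing S] (φ : R →+* S)
    (A : Matrix (Fin 6) (Fin 6) R) : (pfaffianAdjoint A).map φ = pfaffianAdjoint (A.map φ) := by
  ext i j
  fin_cases i <;> fin_cases j <;>
    simp only [pfaffianAdjoint, subPfaffian, Matrix.map_apply, Matrix.of_apply, Matrix.cons_val,
      Fin.reduceFinMk, Fin.mk_one, Fin.zero_eta, map_zero, map_neg, map_sub, map_add, map_mul]

theorem map_quadraticMatrix {R S : Type*} [CommRing R] [CommRing S] (φ : R →+* S) (x₀ : R)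
    (x y : Matrix (Fin 6) (Fin 6) R) (y₀ s : R) :
    (quadraticMatrix x₀ x y y₀ s).map φ
      = quadraticMatrix (φ x₀) (x.map φ) (y.map φ) (φ y₀) (φ s) := by
  have e : ∀ i j, φ (pfaffianAdjoint x i j) = pfaffianAdjoint (x.map φ) i j := fun i j =>
    congrFun (congrFun (map_pfaffianAdjoint φ x) i) j
  have e' : ∀ i j, φ (pfaffianAdjoint y i j) = pfaffianAdjoint (y.map φ) i j := fun i j =>
    congrFun (congrFun (map_pfaffianAdjoint φ y) i) j
  ext (i | i) (j | j) <;>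
    simp [quadraticMatrix, Matrix.mul_apply, Matrix.one_apply, e, e', apply_ite φ]

theorem map_alternatingPairing {R S : Type*} [CommRing R] [CommRing S] (φ : R →+* S)
    (x y : Matrix (Fin 6) (Fin 6) R) :
    φ (alternatingPairing x y) = alternatingPairing (x.map φ) (y.map φ) := by
  simp [alternatingPairing, apply_ite φ]

/-- The matrix of `(ad z)²`, up to a scalar, in terms of the coordinates of the spinor `z`. -/
def spinorMatrix (z : Fock) : Matrix (Fin 6 ⊕ Fin 6) (Fin 6 ⊕ Fin 6) ℂ :=
  quadraticMatrix (z ∅) (spinorX z) (spinorY z) (-z Finset.univ)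
    (1 / 2 * (alternatingPairing (spinorX z) (spinorY z) - z ∅ * -z Finset.univ))

theorem moment_self_eq {z : Fock} (hz : z ∈ HalfSpin) :
    moment z z = (4 : ℂ) • spinorMatrix z := by
  have sX : ∀ i j, spinorX z j i = -spinorX z i j := fun i j => spinorX_skew z i j hz
  have sY : ∀ i j, spinorY z j i = -spinorY z i j := fun i j => spinorY_skew z i j hz
  have hm := (mem_so12_iff _).1 (moment_mem z z)
  ext (i | i) (j | j)
  · rw [moment_self_inl_inl hz]
    by_cases h : i = j
    · simp [spinorMatrix, quadraticMatrix, h]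
      ring
    · simp [spinorMatrix, quadraticMatrix, h]
  · rw [moment_self_inl_inr hz]
    simp [spinorMatrix, quadraticMatrix]
  · rw [moment_self_inr_inl hz]
    simp [spinorMatrix, quadraticMatrix]
  · have h1 := hm (.inl i) (.inr j)
    rw [Sum.swap_inl, Sum.swap_inr, moment_self_inl_inl hz] at h1
    have h2 : (spinorX z * spinorY z) j i = (spinorY z * spinorX z) i j := by
      rw [← Matrix.transpose_apply (spinorX z * spinorY z), Matrix.transpose_mul,
        transpose_eq_neg sX, transpose_eq_neg sY, neg_mul_neg]
    rw [h1, h2]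
    by_cases h : i = j
    · subst h
      simp [spinorMatrix, quadraticMatrix]
      ring
    · simp [spinorMatrix, quadraticMatrix, h, Ne.symm h]

theorem igusaX_skew (i j : Fin 6) : igusaX j i = -igusaX i j := by
  rcases lt_trichotomy i j with h | rfl | h
  · simp [igusaX, h, h.not_gt, Finset.pair_comm j i]
  · simp [igusaX, coord]
  · simp [igusaX, h, h.not_gt, Finset.pair_comm j i]

theorem igusaX_self (i : Fin 6) : igusaX i i = 0 := by
  simp [igusaX, coord]

theorem igusaY_self (i : Fin 6) : igusaY i i = 0 := by
  have h : ∀ i : Fin 6, ¬ Even (({i} : Finset (Fin 6))ᶜ).card := by decide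
  simp only [igusaY, Matrix.of_apply, Finset.pair_eq_singleton, coord, dif_neg (h i), mul_zero]

theorem igusaY_skew (i j : Fin 6) : igusaY j i = -igusaY i j := by
  rcases lt_trichotomy i j with h | rfl | h
  · simp only [igusaY, Matrix.of_apply, h, h.not_gt, Finset.pair_comm j i, add_comm (j : ℕ) i,
      if_true, if_false]
    ring
  · simp [igusaY_self]
  · simp only [igusaY, Matrix.of_apply, h, h.not_gt, Finset.pair_comm j i, add_comm (j : ℕ) i,
      if_true, if_false]
    ring

/-- The matrix of quadratic forms on `Δ` whose value at `z` is `spinorMatrix z`. -/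
def igusaMatrix : Matrix (Fin 6 ⊕ Fin 6) (Fin 6 ⊕ Fin 6) (MvPolynomial EvenSubset ℂ) :=
  quadraticMatrix (coord ∅) igusaX igusaY (-coord Finset.univ)
    (MvPolynomial.C (1 / 2) * (alternatingPairing igusaX igusaY - coord ∅ * -coord Finset.univ))

theorem C_half_mul_two : (2 : MvPolynomial EvenSubset ℂ) * MvPolynomial.C (1 / 2) = 1 := by
  rw [← map_ofNat MvPolynomial.C 2, ← map_mul]
  norm_num

theorem igusaMatrix_mul_self : igusaMatrix * igusaMatrix
    = (-igusaQuartic) • (1 : Matrix (Fin 6 ⊕ Fin 6) (Fin 6 ⊕ Fin 6) (MvPolynomial EvenSubset ℂ)) := by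
  rw [igusaMatrix, quadraticMatrix_mul_self _ _ _ _ _ igusaX_skew igusaX_self igusaY_skew igusaY_self
    (by rw [← mul_assoc, C_half_mul_two, one_mul])]
  congr 2
  have h : (MvPolynomial.C (1 / 4) : MvPolynomial EvenSubset ℂ) = MvPolynomial.C (1 / 2) ^ 2 := by
    rw [← map_pow]
    norm_num
  rw [igusaQuartic, h]
  simp only [alternatingPairing, crossOutPairing]
  ring

theorem evalAt_coord (z : HalfSpin) (S : Finset (Fin 6)) : evalAt z (coord S) = (z : Fock) S := by
  unfold coord evalAt
  split_ifs with h
  · simp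
  · rw [map_zero, z.2 S h]

theorem evalAt_C (z : HalfSpin) (c : ℂ) : evalAt z (MvPolynomial.C c) = c := by
  simp [evalAt]

theorem map_igusaX (z : HalfSpin) : igusaX.map (evalAt z) = spinorX z := by
  ext i j
  simp only [igusaX, spinorX, Matrix.map_apply, Matrix.of_apply, map_mul, evalAt_coord]
  split_ifs <;> simp

theorem map_igusaY (z : HalfSpin) : igusaY.map (evalAt z) = spinorY z := by
  ext i j
  simp only [igusaY, spinorY, Matrix.map_apply, Matrix.of_apply, map_mul, evalAt_coord, map_pow,
    map_neg, map_one]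
  split_ifs <;> simp

theorem map_igusaMatrix (z : HalfSpin) : igusaMatrix.map (evalAt z) = spinorMatrix z := by
  rw [igusaMatrix, map_quadraticMatrix, map_igusaX, map_igusaY, map_mul, evalAt_C, map_sub,
    map_mul, map_neg, map_alternatingPairing, map_igusaX, map_igusaY, evalAt_coord, evalAt_coord,
    spinorMatrix]

theorem isHomogeneous_coord (S : Finset (Fin 6)) : (coord S).IsHomogeneous 1 := by
  unfold coord
  split_ifs
  · exact MvPolynomial.isHomogeneous_X _ _
  · exact MvPolynomial.isHomogeneous_zero _ _ _

theorem isHomogeneous_const_mul {c : MvPolynomial EvenSubset ℂ} {P : MvPolynomial EvenSubset ℂ}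
    {n : ℕ} (hc : c.IsHomogeneous 0) (hP : P.IsHomogeneous n) : (c * P).IsHomogeneous n := by
  simpa using hc.mul hP

theorem isHomogeneous_sign (P : Prop) [Decidable P] :
    (if P then 1 else -1 : MvPolynomial EvenSubset ℂ).IsHomogeneous 0 := by
  split_ifs
  · exact MvPolynomial.isHomogeneous_one _ _
  · exact (MvPolynomial.isHomogeneous_one _ _).neg

theorem isHomogeneous_igusaX (i j : Fin 6) : (igusaX i j).IsHomogeneous 1 :=
  isHomogeneous_const_mul (isHomogeneous_sign _) (isHomogeneous_coord _)

theorem isHomogeneous_igusaY (i j : Fin 6) : (igusaY i j).IsHomogeneous 1 := by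
  refine isHomogeneous_const_mul (isHomogeneous_sign _)
    (isHomogeneous_const_mul ?_ (isHomogeneous_coord _))
  simpa using (MvPolynomial.isHomogeneous_one EvenSubset ℂ).neg.pow ((i : ℕ) + j)

theorem isHomogeneous_pfaffianAdjoint {A : Matrix (Fin 6) (Fin 6) (MvPolynomial EvenSubset ℂ)}
    (hA : ∀ i j, (A i j).IsHomogeneous 1) (i j : Fin 6) :
    (pfaffianAdjoint A i j).IsHomogeneous 2 := by
  have h : ∀ a b c d, (subPfaffian A a b c d).IsHomogeneous 2 := fun a b c d =>
    (((hA a b).mul (hA c d)).sub ((hA a c).mul (hA b d))).add ((hA a d).mul (hA b c))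
  have h0 : (0 : MvPolynomial EvenSubset ℂ).IsHomogeneous 2 :=
    MvPolynomial.isHomogeneous_zero _ _ _
  fin_cases i <;> fin_cases j <;>
    simp only [pfaffianAdjoint, Matrix.of_apply, Matrix.cons_val, Fin.reduceFinMk, Fin.mk_one,
      Fin.zero_eta] <;>
    first | exact h _ _ _ _ | exact (h _ _ _ _).neg | exact h0

theorem isHomogeneous_mul_apply {x y : Matrix (Fin 6) (Fin 6) (MvPolynomial EvenSubset ℂ)}
    (hx : ∀ i j, (x i j).IsHomogeneous 1) (hy : ∀ i j, (y i j).IsHomogeneous 1) (i j : Fin 6) :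
    ((x * y) i j).IsHomogeneous 2 := by
  rw [Matrix.mul_apply]
  exact MvPolynomial.IsHomogeneous.sum _ _ _ fun k _ => (hx i k).mul (hy k j)

theorem isHomogeneous_quadraticMatrix {x₀ y₀ s : MvPolynomial EvenSubset ℂ}
    {x y : Matrix (Fin 6) (Fin 6) (MvPolynomial EvenSubset ℂ)}
    (hx₀ : x₀.IsHomogeneous 1) (hx : ∀ i j, (x i j).IsHomogeneous 1)
    (hy : ∀ i j, (y i j).IsHomogeneous 1) (hy₀ : y₀.IsHomogeneous 1) (hs : s.IsHomogeneous 2)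
    (p q : Fin 6 ⊕ Fin 6) : (quadraticMatrix x₀ x y y₀ s p q).IsHomogeneous 2 := by
  have h1 : ∀ i j : Fin 6,
      ((s • 1 : Matrix (Fin 6) (Fin 6) (MvPolynomial EvenSubset ℂ)) i j).IsHomogeneous 2 := by
    intro i j
    rw [Matrix.smul_apply, Matrix.one_apply, smul_eq_mul]
    split_ifs
    · rwa [mul_one]
    · rw [mul_zero]
      exact MvPolynomial.isHomogeneous_zero _ _ _
  rcases p with i | i <;> rcases q with j | j
  · exact (isHomogeneous_mul_apply hx hy i j).add (h1 i j)
  · exact (hy₀.mul (hx i j)).sub (isHomogeneous_pfaffianAdjoint hy i j)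
  · exact (hx₀.mul (hy i j)).sub (isHomogeneous_pfaffianAdjoint hx i j)
  · exact ((isHomogeneous_mul_apply hy hx i j).add (h1 i j)).neg

theorem isHomogeneous_igusaMatrix (p q : Fin 6 ⊕ Fin 6) :
    (igusaMatrix p q).IsHomogeneous 2 := by
  refine isHomogeneous_quadraticMatrix (isHomogeneous_coord _) isHomogeneous_igusaX
    isHomogeneous_igusaY (isHomogeneous_coord _).neg
    (isHomogeneous_const_mul (MvPolynomial.isHomogeneous_C _ _) (.sub ?_ ?_)) p q
  · refine MvPolynomial.IsHomogeneous.sum _ _ _ fun i _ =>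
      MvPolynomial.IsHomogeneous.sum _ _ _ fun j _ => ?_
    split_ifs
    · exact (isHomogeneous_igusaX i j).mul (isHomogeneous_igusaY i j)
    · exact MvPolynomial.isHomogeneous_zero _ _ _
  · exact (isHomogeneous_coord _).mul (isHomogeneous_coord _).neg

theorem pairing_spin_self (A : Matrix (Fin 6 ⊕ Fin 6) (Fin 6 ⊕ Fin 6) ℂ) (hA : A ∈ so12)
    (z : Fock) : pairing z (spin A z) = 1 / 4 * (moment z z * A).trace := by
  have h := (mem_so12_iff A).1 hA
  have hz : pairing z z = 0 := by linear_combination (1 / 2 : ℂ) * pairing_skew z z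
  have hg : ∀ p q, pairing z (gamma p (gamma q z)) = -(1 / 2) * moment z z p.swap q := by
    intro p q
    have h1 := congrArg (fun F : Module.End ℂ Fock => pairing z (F z)) (gamma_anticomm p q)
    simp only [LinearMap.add_apply, Module.End.mul_apply, map_add, LinearMap.smul_apply,
      Module.End.one_apply, map_smul, hz, smul_zero] at h1
    rw [moment_apply, Sum.swap_swap, pairing_skew ((gamma p * gamma q - gamma q * gamma p) z),
      LinearMap.sub_apply, map_sub,
      Module.End.mul_apply, Module.End.mul_apply]
    linear_combination (1 / 2 : ℂ) * h1
  rw [spin_apply, map_smul, map_sum, Matrix.trace, ← Equiv.sum_comp (Equiv.sumComm (Fin 6) (Fin 6)),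
    smul_eq_mul, Finset.mul_sum, Finset.mul_sum]
  refine Finset.sum_congr rfl fun p _ => ?_
  rw [Matrix.diag_apply, Matrix.mul_apply, map_sum, Finset.mul_sum, Finset.mul_sum]
  refine Finset.sum_congr rfl fun q _ => ?_
  have h1 := h p q.swap
  rw [Sum.swap_swap] at h1
  rw [map_smul, smul_eq_mul, hg, Equiv.sumComm_apply, h1, Sum.swap_swap]
  ring

theorem trace_mul_bivector {M : Matrix (Fin 6 ⊕ Fin 6) (Fin 6 ⊕ Fin 6) ℂ} (hM : M ∈ so12)
    (p q : Fin 6 ⊕ Fin 6) : (M * bivector p q).trace = 2 * M q.swap p := by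
  have h := (mem_so12_iff M).1 hM p q
  have e : ∀ a b : Fin 6 ⊕ Fin 6, a.swap = b ↔ a = b.swap := fun a b =>
    ⟨fun h => by rw [← h, Sum.swap_swap], fun h => by rw [h, Sum.swap_swap]⟩
  simp only [Matrix.trace, Matrix.diag_apply, Matrix.mul_apply, bivector, Matrix.of_apply, mul_sub,
    Finset.sum_sub_distrib, e, ite_and, mul_ite, mul_one, mul_zero, Finset.sum_ite_eq',
    Finset.mem_univ, if_true, h]
  ring

/-- The trace form on `𝔰𝔬₁₂` is nondegenerate. -/
theorem eq_of_trace_mul_eq {M N : Matrix (Fin 6 ⊕ Fin 6) (Fin 6 ⊕ Fin 6) ℂ} (hM : M ∈ so12)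
    (hN : N ∈ so12) (h : ∀ A : so12, (M * A).trace = (N * A).trace) : M = N := by
  ext p q
  have h1 := h ⟨bivector q p.swap, bivector_mem _ _⟩
  rw [trace_mul_bivector hM, trace_mul_bivector hN, Sum.swap_swap] at h1
  exact mul_left_cancel₀ two_ne_zero h1

namespace E7

theorem lie_ofSpin_ofSpin (z w : HalfSpin) :
    ⁅ofSpin z, ofSpin w⁆ = mk 0 0 0 0 0 (2 * spinForm z w) := by
  have z1 : ∀ s, spinForm 0 s = 0 := fun s => by simp [spinForm]
  have z2 : ∀ s, spinMoment 0 s = 0 := fun s => by ext1; simp [spinMoment]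
  have z3 : ∀ s, spinMoment s 0 = 0 := fun s => by ext1; simp [spinMoment]
  have z4 : ∀ s, spinForm s 0 = 0 := fun s => by simp [spinForm]
  rw [lie_def]
  apply ext' <;> simp [ofSpin, z1, z2, z3, z4]

theorem lie_ofSpin_degree_neg_two (z : HalfSpin) (p : ℂ) :
    ⁅ofSpin z, mk p 0 0 0 0 0⁆ = mk 0 (-(p • z)) 0 0 0 0 := by
  have z1 : ∀ s, spinForm 0 s = 0 := fun s => by simp [spinForm]
  have z2 : ∀ s, spinMoment 0 s = 0 := fun s => by ext1; simp [spinMoment]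
  have z3 : ∀ s, spinMoment s 0 = 0 := fun s => by ext1; simp [spinMoment]
  have z4 : ∀ s, spinForm s 0 = 0 := fun s => by simp [spinForm]
  rw [lie_def]
  apply ext' <;> simp [ofSpin, z1, z3, z4]

theorem lie_ofSpin_degree_neg_one (z u : HalfSpin) :
    ⁅ofSpin z, mk 0 u 0 0 0 0⁆ = mk 0 0 (spinMoment z u) (-spinForm z u) 0 0 := by
  have z1 : ∀ s, spinForm 0 s = 0 := fun s => by simp [spinForm]
  have z2 : ∀ s, spinMoment 0 s = 0 := fun s => by ext1; simp [spinMoment]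
  have z4 : ∀ s, spinForm s 0 = 0 := fun s => by simp [spinForm]
  rw [lie_def]
  apply ext' <;> simp [ofSpin, z1, z2, z4]

theorem lie_ofSpin_lie_ofSpin_ofSo (z : HalfSpin) (A : so12) :
    ⁅ofSpin z, ⁅ofSpin z, ofSo A⁆⁆
      = mk 0 0 0 0 0 (-(1 / 2) * (moment z z * (A : Matrix (Fin 6 ⊕ Fin 6) (Fin 6 ⊕ Fin 6) ℂ)).trace) := by
  rw [← lie_skew (ofSpin z) (ofSo A), lie_ofSo_ofSpin, lie_neg, lie_ofSpin_ofSpin, spinForm,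
    coe_lie, pairing_spin_self _ A.2]
  apply ext' <;> simp
  ring

theorem ad_ofSpin_pow_four (z : HalfSpin) (p : ℂ) :
    ((LieAlgebra.ad ℂ E7 (ofSpin z)) ^ 4) (mk p 0 0 0 0 0)
      = mk 0 0 0 0 0 (p / 2 * (moment z z * moment z z).trace) := by
  have hz : spinForm z z = 0 := by linear_combination (1 / 2 : ℂ) * spinForm_skew z z
  have h : mk 0 0 (spinMoment z (-(p • z))) (-spinForm z (-(p • z))) 0 0
      = -(p • ofSo (spinMoment z z)) := by
    rw [← neg_smul, spinForm_smul_right, spinMoment_smul_right, hz]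
    apply ext' <;> simp [ofSo]
  rw [show 4 = 1 + 1 + 1 + 1 from rfl, pow_add, pow_add, pow_add, pow_one]
  simp only [Module.End.mul_apply, LieAlgebra.ad_apply]
  rw [lie_ofSpin_degree_neg_two, lie_ofSpin_degree_neg_one, h, lie_neg, lie_smul, lie_neg,
    lie_smul, lie_ofSpin_lie_ofSpin_ofSo]
  apply ext' <;> simp [spinMoment]
  ring

end E7

theorem moment_mul_self (z : HalfSpin) : moment z z * moment z z
    = (-16 * evalAt z igusaQuartic) • (1 : Matrix (Fin 6 ⊕ Fin 6) (Fin 6 ⊕ Fin 6) ℂ) := by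
  have h := congrArg (fun M => M.map (evalAt z)) igusaMatrix_mul_self
  simp only [Matrix.map_mul, map_igusaMatrix] at h
  rw [moment_self_eq z.2, smul_mul_smul_comm, h]
  ext i j
  by_cases hij : i = j
  · norm_num [hij]
  · simp [hij]

theorem ad_pow_four_eq (z : HalfSpin) (p : ℂ) :
    ((LieAlgebra.ad ℂ E7 (E7.ofSpin z)) ^ 4) (E7.mk p 0 0 0 0 0)
      = (-96 * p * evalAt z igusaQuartic) • E7.mk 0 0 0 0 0 1 := by
  rw [E7.ad_ofSpin_pow_four, moment_mul_self, Matrix.trace_smul, Matrix.trace_one]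
  apply E7.ext' <;> simp
  ring

/-- The matrix of `(ad z)²` with respect to the generator of degree `2` with coordinate `q`. -/
def adSqMatrix (q : ℂ) :
    Matrix (Fin 6 ⊕ Fin 6) (Fin 6 ⊕ Fin 6) (MvPolynomial EvenSubset ℂ) :=
  (MvPolynomial.C (-2 / q) : MvPolynomial EvenSubset ℂ) • igusaMatrix

theorem map_adSqMatrix (q : ℂ) (z : HalfSpin) :
    (adSqMatrix q).map (evalAt z) = (-1 / (2 * q)) • moment z z := by
  rw [moment_self_eq z.2, smul_smul, ← map_igusaMatrix]
  ext i j
  simp only [adSqMatrix, Matrix.map_apply, Matrix.smul_apply, smul_eq_mul, map_mul, evalAt_C]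
  ring

theorem isAdSqMatrix_adSqMatrix {q : ℂ} (hq : q ≠ 0) :
    IsAdSqMatrix (E7.mk 0 0 0 0 0 q) (adSqMatrix q) := by
  refine ⟨fun i j => isHomogeneous_const_mul (MvPolynomial.isHomogeneous_C _ _)
    (isHomogeneous_igusaMatrix i j), fun z M => ?_⟩
  have hmem : (-1 / (2 * q)) • moment z z ∈ so12 := by
    have h := moment_mem ((-1 / (2 * q)) • (z : Fock)) z
    rwa [map_smul, LinearMap.smul_apply] at h
  have key : ∀ (N : Matrix (Fin 6 ⊕ Fin 6) (Fin 6 ⊕ Fin 6) ℂ) (A : so12),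
      ⁅E7.ofSpin z, ⁅E7.ofSpin z, E7.ofSo A⁆⁆ = (N * A).trace • E7.mk 0 0 0 0 0 q ↔
        (N * A).trace = (((-1 / (2 * q)) • moment z z) * A).trace := by
    intro N A
    have h1 : (((-1 / (2 * q)) • moment z z) * A).trace * q
        = -(1 / 2) * (moment z z * (A : Matrix (Fin 6 ⊕ Fin 6) (Fin 6 ⊕ Fin 6) ℂ)).trace := by
      rw [smul_mul_assoc, Matrix.trace_smul, smul_eq_mul]
      field_simp
    rw [E7.lie_ofSpin_lie_ofSpin_ofSo, ← h1]
    constructor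
    · intro h
      have h2 := congrArg E7.c2 h
      simp only [map_smul, E7.c2_mk, smul_eq_mul] at h2
      exact (mul_right_cancel₀ hq h2).symm
    · intro h
      rw [h]
      apply E7.ext' <;> simp
  rw [map_adSqMatrix]
  constructor
  · rintro ⟨hM, h⟩
    exact eq_of_trace_mul_eq hM hmem fun A => (key M A).1 (h A)
  · rintro rfl
    exact ⟨hmem, fun A => (key _ A).2 rfl⟩

theorem isMatrixFactorization_adSqMatrix (q : ℂ) :
    IsMatrixFactorization (adSqMatrix q) (adSqMatrix q) ((-4 / q ^ 2) • igusaQuartic) := by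
  have h : adSqMatrix q * adSqMatrix q = ((-4 / q ^ 2) • igusaQuartic) •
      (1 : Matrix (Fin 6 ⊕ Fin 6) (Fin 6 ⊕ Fin 6) (MvPolynomial EvenSubset ℂ)) := by
    rw [adSqMatrix, smul_mul_smul_comm, igusaMatrix_mul_self, smul_smul, ← map_mul,
      MvPolynomial.smul_eq_C_mul, mul_neg, ← neg_mul, ← map_neg]
    congr 3
    ring
  exact ⟨h, h⟩

end SpinE7
end

theorem mainTheorem6 :
    (∀ Xm ∈ SpinE7.E7.grade (-2), Xm ≠ 0 → ∀ Xp ∈ SpinE7.E7.grade 2, Xp ≠ 0 →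
      ∃ (a c : ℂ) (N : Matrix (Fin 6 ⊕ Fin 6) (Fin 6 ⊕ Fin 6)
          (MvPolynomial SpinE7.EvenSubset ℂ)),
        a ≠ 0 ∧ c ≠ 0 ∧
        (∀ z : SpinE7.HalfSpin, ((LieAlgebra.ad ℂ SpinE7.E7 (SpinE7.E7.ofSpin z)) ^ 4) Xm
          = (a * SpinE7.evalAt z SpinE7.igusaQuartic) • Xp) ∧
        SpinE7.IsAdSqMatrix Xp N ∧
        SpinE7.IsMatrixFactorization N N (c • SpinE7.igusaQuartic)) ∧
    (∃ Xm ∈ SpinE7.E7.grade (-2), ∃ Xp ∈ SpinE7.E7.grade 2, Xm ≠ 0 ∧ Xp ≠ 0 ∧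
      ∃ N : Matrix (Fin 6 ⊕ Fin 6) (Fin 6 ⊕ Fin 6) (MvPolynomial SpinE7.EvenSubset ℂ),
        (∀ z : SpinE7.HalfSpin, ((LieAlgebra.ad ℂ SpinE7.E7 (SpinE7.E7.ofSpin z)) ^ 4) Xm
          = SpinE7.evalAt z SpinE7.igusaQuartic • Xp) ∧
        SpinE7.IsAdSqMatrix Xp N ∧
        SpinE7.IsMatrixFactorization N N SpinE7.igusaQuartic) := by
  have h0 : SpinE7.E7.mk 0 0 0 0 0 0 = 0 := rfl
  have hsmul : ∀ c q : ℂ, c • SpinE7.E7.mk 0 0 0 0 0 q = SpinE7.E7.mk 0 0 0 0 0 (c * q) := by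
    intro c q
    apply SpinE7.E7.ext' <;> simp
  constructor
  · intro Xm hXm hm Xp hXp hp
    obtain ⟨p, rfl⟩ := (SpinE7.E7.mem_grade_neg_two_iff _).1 hXm
    obtain ⟨q, rfl⟩ := (SpinE7.E7.mem_grade_two_iff _).1 hXp
    have hp0 : p ≠ 0 := by rintro rfl; exact hm h0
    have hq0 : q ≠ 0 := by rintro rfl; exact hp h0
    refine ⟨-96 * p / q, -4 / q ^ 2, SpinE7.adSqMatrix q, by simp [hp0, hq0], by simp [hq0],
      fun z => ?_, SpinE7.isAdSqMatrix_adSqMatrix hq0,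
      SpinE7.isMatrixFactorization_adSqMatrix q⟩
    rw [SpinE7.ad_pow_four_eq, hsmul, hsmul]
    congr 1
    field_simp
  · have hq : (2 * Complex.I) ≠ 0 := by simp
    have hq2 : -4 / (2 * Complex.I) ^ 2 = 1 := by
      rw [mul_pow, Complex.I_sq]
      norm_num
    refine ⟨SpinE7.E7.mk (-(2 * Complex.I) / 96) 0 0 0 0 0,
      (SpinE7.E7.mem_grade_neg_two_iff _).2 ⟨_, rfl⟩, SpinE7.E7.mk 0 0 0 0 0 (2 * Complex.I),
      (SpinE7.E7.mem_grade_two_iff _).2 ⟨_, rfl⟩, fun h => ?_, fun h => ?_,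
      SpinE7.adSqMatrix (2 * Complex.I), fun z => ?_, SpinE7.isAdSqMatrix_adSqMatrix hq, ?_⟩
    · have h1 := congrArg SpinE7.E7.cm2 h
      simp at h1
    · have h1 := congrArg SpinE7.E7.c2 h
      simp at h1
    · rw [SpinE7.ad_pow_four_eq, hsmul, hsmul]
      congr 1
      ring
    · have h1 := SpinE7.isMatrixFactorization_adSqMatrix (2 * Complex.I)
      rwa [hq2, one_smul] at h1
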